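/- Let $(Q,\mathfrak m,\mathsf k)$ be a commutative local ring (not necessarily Noetherian) with $\mathrm{char}\,\mathsf k=0$. Let $(f,g)$ be an exact pair of zero divisors in $Q$, that is, $f,g\in Q$ are nonzero, $\mathrm{ann}_Q(f)=(g)$ and $\mathrm{ann}_Q(g)=(f)$, and set $R=Q/(f)$. Let $M,N$ be $R$-modules (not necessarily finitely generated) with $gN=0$. Put $\mathrm{Tor}_j=0$ for $j<0$. Suppose that there are integers $m,n\ge 0$ with $n-m\ge 1$ and $$\mathrm{Tor}^R_i(M,N)=0\qquad\text{for } m\le i\le n .$$ Then there are isomorphisms of $Q$-modules $$\mathrm{Tor}^Q_{i-1}(M,N)\cong \mathrm{Tor}^Q_{i+1}(M,N)\qquad\text{for } m\le i\le n-2,$$ and there is an exact sequence of $Q$-modules $$\mathrm{Tor}^Q_{m-2}(M,N)\to \mathrm{Tor}^Q_{m}(M,N)\to \mathrm{Tor}^R_{m-1}(M,N)\to \mathrm{Tor}^Q_{m-3}(M,N).$$ Furthermore, if $m=1$, then $M\otimes_Q N\cong \mathrm{Tor}^Q_i(M,N)$ as $Q$-modules for $1\le i\le n-1$. -/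

import Mathlib

universe u

/-- `(f, g)` is an exact pair of zero divisors of `Q`: both elements are nonzero,
`ann_Q(f) = (g)` and `ann_Q(g) = (f)`. -/
structure IsExactPairOfZeroDivisors {Q : Type u} [CommRing Q] (f g : Q) : Prop where
  left_ne_zero : f ≠ 0
  right_ne_zero : g ≠ 0
  ann_left : ∀ x : Q, x * f = 0 ↔ x ∈ Ideal.span {g}
  ann_right : ∀ x : Q, x * g = 0 ↔ x ∈ Ideal.span {f}

/-- `Tor_i^A(M, N)` for an arbitrary integer `i`, as an `A`-module.  For `i ≥ 0` it is the `i`-th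
left derived functor of `- ⊗_A N` evaluated at `M` (the homology of `P ⊗_A N` for a projective
resolution `P` of `M` over `A`); for `i < 0` it is zero. -/
noncomputable def torModule (A : Type u) [CommRing A] (M N : Type u)
    [AddCommGroup M] [Module A M] [AddCommGroup N] [Module A N] : ℤ → ModuleCat.{u} A
  | Int.ofNat i =>
      ((CategoryTheory.Tor' (ModuleCat.{u} A) i).obj (ModuleCat.of A M)).obj (ModuleCat.of A N)
  | Int.negSucc _ => ModuleCat.of A PUnit.{u + 1}

/-- An `R`-module regarded as a `Q`-module, for `R = Q/(f)`, through the projection `Q → Q/(f)`. -/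
noncomputable abbrev asModuleOver {Q : Type u} [CommRing Q] (f : Q)
    (T : ModuleCat.{u} (Q ⧸ Ideal.span {f})) : ModuleCat.{u} Q :=
  (ModuleCat.restrictScalars (Ideal.Quotient.mk (Ideal.span {f}))).obj T

open CategoryTheory TensorProduct

/-! Resolve `N` by projectives `F` over `Q` and put `C = R ⊗ F`; then `M ⊗_R C = M ⊗_Q F` computes
Tor over `Q`. Both `f` and `g` kill `N`, so they act on `F` with null homotopies `X` and `T`;
moreover `g X` bounds an operator `Y`. The operator `y = Y - T X` of degree two commutes with `d`
modulo `f`, hence acts on `C`.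

Since `(f, g)` is an exact pair, a cycle `c` of `C` gives a zigzag `d c = f b`, `d b = g a`. The
class of `a` defines Δ : H_{k+2}(C) → H_k(C), injective for k ≥ 0. A direct computation gives Δ(y a)
= a + y(Δ a), so by induction on the degree Δ y is multiplication by a positive integer
(`exists_nat_connecting_y`), a unit in residue characteristic zero. Hence `y` is an isomorphism
H_k(C) → H_{k+2}(C) for k ≥ 0, while H_0(C) ≅ N ≅ H_1(C), the second isomorphism being induced by
`X`.

The cone of `y` therefore has only two homology modules, both `N`, in adjacent degrees. Attaching a
projective resolution of `N` over `R` kills the upper one and leaves a flat `R`-resolution of `N`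
(`exists_resolution`). Tensoring the two cones with `M` yields, with h_j the homology of the first,
Tor^Q_{j-2} → Tor^Q_j → h_j → Tor^Q_{j-3} and Tor^R_{j+1} → Tor^R_{j-1} → h_j → Tor^R_j →
Tor^R_{j-2}. The vanishing assumption gives h_j = 0 for m < j ≤ n and h_m ≅ Tor^R_{m-1}; the first
sequence then gives all the claims. -/

/-- The homology `ker g / im f` of `X → Y → Z` at `Y`. -/
abbrev MiddleHomology {A : Type*} [CommRing A] {X Y Z : Type*}
    [AddCommGroup X] [Module A X] [AddCommGroup Y] [Module A Y] [AddCommGroup Z] [Module A Z]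
    (f : X →ₗ[A] Y) (g : Y →ₗ[A] Z) : Type _ :=
  ↥(LinearMap.ker g) ⧸ (LinearMap.range f).submoduleOf (LinearMap.ker g)

/-! ### Homology of two composable maps, and connecting isomorphisms -/

section Homology

variable {A : Type*} [CommRing A]

/-- Two surjections from one module with the same kernel have isomorphic targets. -/
noncomputable def LinearEquiv.ofSurjectiveOfKerEq {G X Y : Type*} [AddCommGroup G] [Module A G]
    [AddCommGroup X] [Module A X] [AddCommGroup Y] [Module A Y]
    (f : G →ₗ[A] X) (g : G →ₗ[A] Y) (hf : Function.Surjective f) (hg : Function.Surjective g)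
    (h : ∀ x, f x = 0 ↔ g x = 0) : X ≃ₗ[A] Y :=
  (f.quotKerEquivOfSurjective hf).symm ≪≫ₗ
    Submodule.quotEquivOfEq _ _ (by ext x; exact h x) ≪≫ₗ g.quotKerEquivOfSurjective hg

variable {X Y Z X' Y' Z' : Type*}
  [AddCommGroup X] [Module A X] [AddCommGroup Y] [Module A Y] [AddCommGroup Z] [Module A Z]
  [AddCommGroup X'] [Module A X'] [AddCommGroup Y'] [Module A Y'] [AddCommGroup Z'] [Module A Z']

namespace MiddleHomology

/-- The class of a cycle. -/
def mk (f : X →ₗ[A] Y) (g : Y →ₗ[A] Z) (y : Y) (hy : g y = 0) : MiddleHomology f g :=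
  Submodule.Quotient.mk ⟨y, hy⟩

lemma mk_surjective (f : X →ₗ[A] Y) (g : Y →ₗ[A] Z) (c : MiddleHomology f g) :
    ∃ y hy, mk f g y hy = c := by
  obtain ⟨⟨y, hy⟩, rfl⟩ := Submodule.Quotient.mk_surjective _ c
  exact ⟨y, hy, rfl⟩

lemma mk_eq_zero (f : X →ₗ[A] Y) (g : Y →ₗ[A] Z) (y : Y) (hy : g y = 0) :
    mk f g y hy = 0 ↔ ∃ x, f x = y := by
  unfold mk
  rw [Submodule.Quotient.mk_eq_zero]
  exact Iff.rfl

/-- The map on homology induced by a linear map preserving cycles and boundaries. -/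
def map (f : X →ₗ[A] Y) (g : Y →ₗ[A] Z) (f' : X' →ₗ[A] Y') (g' : Y' →ₗ[A] Z')
    (e : Y →ₗ[A] Y') (hg : ∀ y, g y = 0 → g' (e y) = 0) (hf : ∀ x, ∃ x', f' x' = e (f x)) :
    MiddleHomology f g →ₗ[A] MiddleHomology f' g' :=
  Submodule.mapQ _ _ (e.restrict hg) (by
    rintro ⟨y, hy⟩ ⟨x, rfl⟩
    exact hf x)

@[simp] lemma map_mk (f : X →ₗ[A] Y) (g : Y →ₗ[A] Z) (f' : X' →ₗ[A] Y') (g' : Y' →ₗ[A] Z')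
    (e : Y →ₗ[A] Y') (hg : ∀ y, g y = 0 → g' (e y) = 0) (hf : ∀ x, ∃ x', f' x' = e (f x))
    (y : Y) (hy : g y = 0) :
    map f g f' g' e hg hf (mk f g y hy) = mk f' g' (e y) (hg y hy) := rfl

/-- The quotient map from cycles to homology. -/
abbrev π (f : X →ₗ[A] Y) (g : Y →ₗ[A] Z) : LinearMap.ker g →ₗ[A] MiddleHomology f g :=
  Submodule.mkQ _

/-- Homology is invariant under isomorphisms matching cycles and boundaries. -/
noncomputable def congr (f : X →ₗ[A] Y) (g : Y →ₗ[A] Z) (f' : X' →ₗ[A] Y') (g' : Y' →ₗ[A] Z')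
    (e : Y ≃ₗ[A] Y') (hg : ∀ y, g y = 0 ↔ g' (e y) = 0)
    (hf : ∀ y, (∃ x, f x = y) ↔ ∃ x', f' x' = e y) :
    MiddleHomology f g ≃ₗ[A] MiddleHomology f' g' :=
  LinearEquiv.ofSurjectiveOfKerEq (π f g)
    (π f' g' ∘ₗ e.toLinearMap.restrict fun y hy => (hg y).1 hy)
    (Submodule.mkQ_surjective _)
    (fun c => by
      obtain ⟨y, hy, rfl⟩ := mk_surjective _ _ c
      refine ⟨⟨e.symm y, (hg _).2 (by simpa using hy)⟩, ?_⟩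
      change mk f' g' (e (e.symm y)) _ = _
      congr 1
      simp)
    (fun ⟨y, hy⟩ => by
      exact (mk_eq_zero f g y hy).trans
        ((hf y).trans (mk_eq_zero f' g' (e y) ((hg y).1 hy)).symm))

/-- The connecting isomorphism of a short exact sequence whose middle term is acyclic; the
lowest map of the sequence need not be injective. -/
noncomputable def connecting {A₂ A₁ A₀ B₃ B₂ B₁ B₀ D₃ D₂ D₁ : Type*}
    [AddCommGroup A₂] [Module A A₂] [AddCommGroup A₁] [Module A A₁]
    [AddCommGroup A₀] [Module A A₀] [AddCommGroup B₃] [Module A B₃]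
    [AddCommGroup B₂] [Module A B₂] [AddCommGroup B₁] [Module A B₁]
    [AddCommGroup B₀] [Module A B₀] [AddCommGroup D₃] [Module A D₃]
    [AddCommGroup D₂] [Module A D₂] [AddCommGroup D₁] [Module A D₁]
    (a₂ : A₂ →ₗ[A] A₁) (a₁ : A₁ →ₗ[A] A₀)
    (b₃ : B₃ →ₗ[A] B₂) (b₂ : B₂ →ₗ[A] B₁) (b₁ : B₁ →ₗ[A] B₀)
    (d₃ : D₃ →ₗ[A] D₂) (d₂ : D₂ →ₗ[A] D₁)
    (i₂ : A₂ →ₗ[A] B₂) (i₁ : A₁ →ₗ[A] B₁) (i₀ : A₀ →ₗ[A] B₀)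
    (p₃ : B₃ →ₗ[A] D₃) (p₂ : B₂ →ₗ[A] D₂) (p₁ : B₁ →ₗ[A] D₁)
    (hi₂ : ∀ x, b₂ (i₂ x) = i₁ (a₂ x)) (hi₁ : ∀ x, b₁ (i₁ x) = i₀ (a₁ x))
    (hp₃ : ∀ x, p₂ (b₃ x) = d₃ (p₃ x)) (hp₂ : ∀ x, p₁ (b₂ x) = d₂ (p₂ x))
    (hb₂ : Function.Exact b₃ b₂) (hb₁ : Function.Exact b₂ b₁)
    (h₂ : Function.Exact i₂ p₂) (h₁ : Function.Exact i₁ p₁) (inj₁ : Function.Injective i₁)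
    (surj₃ : Function.Surjective p₃) (surj₂ : Function.Surjective p₂) :
    MiddleHomology d₃ d₂ ≃ₗ[A] MiddleHomology a₂ (i₀ ∘ₗ a₁) :=
  -- The zigzag relation itself: it surjects onto both homology modules and the two kernels agree,
  -- so no lifts have to be chosen.
  let Γ : Submodule A (B₂ × A₁) :=
    LinearMap.ker (b₂ ∘ₗ LinearMap.fst A B₂ A₁ - i₁ ∘ₗ LinearMap.snd A B₂ A₁)
  have hΓ : ∀ x : Γ, b₂ x.1.1 = i₁ x.1.2 := fun x => sub_eq_zero.1 x.2
  have hc : ∀ x : Γ, d₂ (p₂ x.1.1) = 0 := fun x => by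
    rw [← hp₂, hΓ]; exact h₁.apply_apply_eq_zero _
  have hc' : ∀ x : Γ, i₀ (a₁ x.1.2) = 0 := fun x => by
    rw [← hi₁, ← hΓ]; exact hb₁.apply_apply_eq_zero _
  LinearEquiv.ofSurjectiveOfKerEq (G := Γ)
    (π d₃ d₂ ∘ₗ (p₂ ∘ₗ LinearMap.fst A B₂ A₁ ∘ₗ Γ.subtype).codRestrict _ hc)
    (π a₂ (i₀ ∘ₗ a₁) ∘ₗ (LinearMap.snd A B₂ A₁ ∘ₗ Γ.subtype).codRestrict _ hc')
    (fun c => by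
      obtain ⟨y, hy, rfl⟩ := mk_surjective _ _ c
      obtain ⟨x, rfl⟩ := surj₂ y
      obtain ⟨w, hw⟩ := (h₁ (b₂ x)).1 (by rw [hp₂, hy])
      exact ⟨⟨(x, w), sub_eq_zero.2 hw.symm⟩, rfl⟩)
    (fun c => by
      obtain ⟨w, hw, rfl⟩ := mk_surjective _ _ c
      obtain ⟨x, hx⟩ := (hb₁ (i₁ w)).1 (by rw [hi₁]; exact hw)
      exact ⟨⟨(x, w), sub_eq_zero.2 hx⟩, rfl⟩)
    (fun z => by
      have hz := hΓ z
      change mk d₃ d₂ (p₂ z.1.1) (hc z) = 0 ↔ mk a₂ (i₀ ∘ₗ a₁) z.1.2 (hc' z) = 0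
      rw [mk_eq_zero, mk_eq_zero]
      constructor
      · rintro ⟨y, hy⟩
        obtain ⟨y, rfl⟩ := surj₃ y
        obtain ⟨v, hv⟩ := (h₂ (z.1.1 - b₃ y)).1 (by rw [map_sub, hp₃, hy, sub_self])
        refine ⟨v, inj₁ ?_⟩
        rw [← hi₂, hv, map_sub, hb₂.apply_apply_eq_zero, sub_zero, hz]
      · rintro ⟨v, hv⟩
        obtain ⟨y, hy⟩ := (hb₂ (z.1.1 - i₂ v)).1 (by rw [map_sub, hi₂, hv, hz, sub_self])
        exact ⟨p₃ y, by rw [← hp₃, hy, map_sub, h₂.apply_apply_eq_zero, sub_zero]⟩)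

end MiddleHomology

end Homology

/-! ### Tor as the homology of a tensored projective resolution -/

section Tor

variable (A : Type u) [CommRing A] (M : Type u) [AddCommGroup M] [Module A M]

/-- The homology of a short complex of modules as `MiddleHomology`. -/
noncomputable def CategoryTheory.ShortComplex.homologyEquivMiddleHomology
    (S : ShortComplex (ModuleCat.{u} A)) :
    S.homology ≃ₗ[A] MiddleHomology S.f.hom S.g.hom :=
  S.moduleCatHomologyIso.toLinearEquiv ≪≫ₗ Submodule.quotEquivOfEq _ _ (by
    ext ⟨x, hx⟩
    constructor
    · rintro ⟨y, hy⟩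
      exact ⟨y, congrArg Subtype.val hy⟩
    · rintro ⟨y, hy⟩
      exact ⟨y, Subtype.ext hy⟩)

/-- `Tor_0` is the tensor product. -/
noncomputable def torZeroEquiv (N : Type u) [AddCommGroup N] [Module A N] :
    torModule A M N 0 ≃ₗ[A] M ⊗[A] N :=
  ((Functor.leftDerivedZeroIsoSelf ((MonoidalCategory.tensoringRight (ModuleCat.{u} A)).obj
    (ModuleCat.of A N))).app (ModuleCat.of A M)).toLinearEquiv

/-- A module has a projective resolution computing all its Tor modules. -/
theorem exists_projective_resolution_tor :
    ∃ (P : ℕ → ModuleCat.{u} A) (d : ∀ n, P (n + 1) →ₗ[A] P n) (ε : P 0 →ₗ[A] M),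
      (∀ n, Module.Projective A (P n)) ∧ Function.Surjective ε ∧ Function.Exact (d 0) ε ∧
      (∀ n, Function.Exact (d (n + 1)) (d n)) ∧
      ∀ (N : Type u) [AddCommGroup N] [Module A N] (n : ℕ),
        Nonempty (torModule A M N ((n + 1 : ℕ) : ℤ) ≃ₗ[A]
          MiddleHomology ((d (n + 1)).rTensor N) ((d n).rTensor N)) := by
  let P := projectiveResolution (ModuleCat.of A M)
  refine ⟨P.complex.X, fun n => (P.complex.d (n + 1) n).hom, (P.π.f 0).hom, ?_, ?_, ?_, ?_, ?_⟩
  · intro n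
    have := P.projective n
    exact (IsProjective.iff_projective _).2 this
  · exact (ModuleCat.epi_iff_surjective _).1 inferInstance
  · exact (ShortComplex.ShortExact.moduleCat_exact_iff_function_exact _).1 P.exact₀
  · exact fun n => (ShortComplex.ShortExact.moduleCat_exact_iff_function_exact _).1
      (P.exact_succ n)
  · intro N _ _ n
    let F := (MonoidalCategory.tensoringRight (ModuleCat.{u} A)).obj (ModuleCat.of A N)
    let K := (F.mapHomologicalComplex (ComplexShape.down ℕ)).obj P.complex
    let e₁ := P.isoLeftDerivedObj F (n + 1)
    let e₂ := ShortComplex.homologyMapIso (K.isoSc' (n + 2) (n + 1) n (by simp) (by simp))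
    exact ⟨(e₁ ≪≫ e₂).toLinearEquiv ≪≫ₗ
      ShortComplex.homologyEquivMiddleHomology A (K.sc' (n + 2) (n + 1) n)⟩

end Tor

/-! ### Balancing Tor: flat resolutions of the second argument -/

/-- Tensoring maps on the two sides commutes. -/
lemma lTensor_rTensor_comm_apply {A X Y X' Y' : Type*} [CommRing A] [AddCommGroup X]
    [AddCommGroup Y] [AddCommGroup X'] [AddCommGroup Y'] [Module A X] [Module A Y] [Module A X']
    [Module A Y'] (f : X →ₗ[A] Y) (h : X' →ₗ[A] Y') (x : X ⊗[A] X') :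
    h.lTensor Y (f.rTensor X' x) = f.rTensor Y' (h.lTensor X x) := by
  rw [← LinearMap.comp_apply, ← LinearMap.comp_apply, LinearMap.lTensor_comp_rTensor,
    LinearMap.rTensor_comp_lTensor]

section Balance

variable (A : Type u) [CommRing A] (M : Type u) [AddCommGroup M] [Module A M]

/-- `Tor` is computed by flat resolutions of the second argument. -/
theorem nonempty_torModule_equiv_of_flat_resolution (n : ℕ) :
    ∀ (N : Type u) [AddCommGroup N] [Module A N] (C : ℕ → Type u)
      [∀ i, AddCommGroup (C i)] [∀ i, Module A (C i)] [∀ i, Module.Flat A (C i)]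
      (d : ∀ i, C (i + 1) →ₗ[A] C i) (ε : C 0 →ₗ[A] N), Function.Surjective ε →
      Function.Exact (d 0) ε → (∀ i, Function.Exact (d (i + 1)) (d i)) →
      Nonempty (torModule A M N ((n + 1 : ℕ) : ℤ) ≃ₗ[A]
        MiddleHomology ((d (n + 1)).lTensor M) ((d n).lTensor M)) := by
  obtain ⟨P, dP, εP, hP, hεP, hP0, hPn, hT⟩ := exists_projective_resolution_tor A M
  have hfl : ∀ n, Module.Flat A (P n) := fun n => Module.Flat.of_projective
  induction n with
  | zero =>
    intro N _ _ C _ _ _ d ε hε h0 hn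
    obtain ⟨t⟩ := hT N 0
    -- `M ⊗ L → M ⊗ C 0` need not be injective. Its kernel is shown to be both Tor_1 and the
    -- homology of `M ⊗ C` in degree one.
    let L := LinearMap.ker ε
    let ι : L →ₗ[A] C 0 := L.subtype
    have hιε : Function.Exact ι ε :=
      fun x => ⟨fun hx => ⟨⟨x, hx⟩, rfl⟩, by rintro ⟨y, rfl⟩; exact y.2⟩
    let d' : C 1 →ₗ[A] L := (d 0).codRestrict _ h0.apply_apply_eq_zero
    have hd' : Function.Surjective d' := fun ⟨x, hx⟩ => by
      obtain ⟨y, hy⟩ := (h0 x).1 hx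
      exact ⟨y, Subtype.ext hy⟩
    have hdd' : Function.Exact (d 1) d' := fun x => by
      rw [← hn 0 x]
      exact ⟨fun h => congrArg Subtype.val h, fun h => Subtype.ext h⟩
    -- connecting isomorphism to the kernel of `M ⊗ L → M ⊗ C 0`
    let e₁ := MiddleHomology.connecting ((dP 0).rTensor L) (εP.rTensor L)
      ((dP 1).rTensor (C 0)) ((dP 0).rTensor (C 0)) (εP.rTensor (C 0))
      ((dP 1).rTensor N) ((dP 0).rTensor N)
      (ι.lTensor (P 1)) (ι.lTensor (P 0)) (ι.lTensor M)
      (ε.lTensor (P 2)) (ε.lTensor (P 1)) (ε.lTensor (P 0))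
      (fun x => (lTensor_rTensor_comm_apply _ _ x).symm) (fun x => (lTensor_rTensor_comm_apply _ _ x).symm) (fun x => lTensor_rTensor_comm_apply _ _ x)
      (fun x => lTensor_rTensor_comm_apply _ _ x)
      (Module.Flat.rTensor_exact _ (hPn 0)) (rTensor_exact _ hP0 hεP)
      (lTensor_exact _ hιε hε) (lTensor_exact _ hιε hε)
      (Module.Flat.lTensor_preserves_injective_linearMap _ Subtype.val_injective)
      (LinearMap.lTensor_surjective _ hε) (LinearMap.lTensor_surjective _ hε)
    let e₂ : MiddleHomology ((dP 0).rTensor L) (ι.lTensor M ∘ₗ εP.rTensor L) ≃ₗ[A]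
        LinearMap.ker (ι.lTensor M) :=
      LinearEquiv.ofSurjectiveOfKerEq (MiddleHomology.π _ _)
        ((εP.rTensor L).restrict fun x hx => hx) (Submodule.mkQ_surjective _)
        (fun ⟨x, hx⟩ => by
          obtain ⟨y, rfl⟩ := LinearMap.rTensor_surjective L hεP x
          exact ⟨⟨y, hx⟩, rfl⟩)
        (fun ⟨x, hx⟩ => (MiddleHomology.mk_eq_zero _ _ x hx).trans
          ((rTensor_exact L hP0 hεP x).symm.trans
            ⟨fun h => Subtype.ext h, fun h => congrArg Subtype.val h⟩))
    have hcomp : ∀ x, ι.lTensor M (d'.lTensor M x) = (d 0).lTensor M x := fun x => by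
      rw [← LinearMap.comp_apply, ← LinearMap.lTensor_comp]
      rfl
    let e₃ : MiddleHomology ((d 1).lTensor M) ((d 0).lTensor M) ≃ₗ[A]
        LinearMap.ker (ι.lTensor M) :=
      LinearEquiv.ofSurjectiveOfKerEq (MiddleHomology.π _ _)
        ((d'.lTensor M).restrict fun x hx => (hcomp x).trans hx) (Submodule.mkQ_surjective _)
        (fun ⟨x, hx⟩ => by
          obtain ⟨y, rfl⟩ := LinearMap.lTensor_surjective M hd' x
          exact ⟨⟨y, (hcomp y).symm.trans hx⟩, rfl⟩)
        (fun ⟨x, hx⟩ => (MiddleHomology.mk_eq_zero _ _ x hx).trans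
          ((lTensor_exact M hdd' hd' x).symm.trans
            ⟨fun h => Subtype.ext h, fun h => congrArg Subtype.val h⟩))
    exact ⟨t ≪≫ₗ e₁ ≪≫ₗ e₂ ≪≫ₗ e₃.symm⟩
  | succ n ih =>
    intro N _ _ C _ _ _ d ε hε h0 hn
    obtain ⟨t⟩ := hT N (n + 1)
    let L := LinearMap.ker ε
    obtain ⟨t'⟩ := hT L n
    let ι : L →ₗ[A] C 0 := L.subtype
    have hιε : Function.Exact ι ε :=
      fun x => ⟨fun hx => ⟨⟨x, hx⟩, rfl⟩, by rintro ⟨y, rfl⟩; exact y.2⟩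
    let d' : C 1 →ₗ[A] L := (d 0).codRestrict _ h0.apply_apply_eq_zero
    have hd' : Function.Surjective d' := fun ⟨x, hx⟩ => by
      obtain ⟨y, hy⟩ := (h0 x).1 hx
      exact ⟨y, Subtype.ext hy⟩
    have hdd' : Function.Exact (d 1) d' := fun x => by
      rw [← hn 0 x]
      exact ⟨fun h => congrArg Subtype.val h, fun h => Subtype.ext h⟩
    -- Dimension shifting: the tail of `C` is a flat resolution of `L`, and flatness of `C 0` makes
    -- the middle row below acyclic.
    obtain ⟨s⟩ := ih L (fun i => C (i + 1)) (fun i => d (i + 1)) d' hd' hdd' (fun i => hn (i + 1))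
    let e₁ := MiddleHomology.connecting ((dP (n + 1)).rTensor L) ((dP n).rTensor L)
      ((dP (n + 2)).rTensor (C 0)) ((dP (n + 1)).rTensor (C 0)) ((dP n).rTensor (C 0))
      ((dP (n + 2)).rTensor N) ((dP (n + 1)).rTensor N)
      (ι.lTensor (P (n + 2))) (ι.lTensor (P (n + 1))) (ι.lTensor (P n))
      (ε.lTensor (P (n + 3))) (ε.lTensor (P (n + 2))) (ε.lTensor (P (n + 1)))
      (fun x => (lTensor_rTensor_comm_apply _ _ x).symm) (fun x => (lTensor_rTensor_comm_apply _ _ x).symm) (fun x => lTensor_rTensor_comm_apply _ _ x)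
      (fun x => lTensor_rTensor_comm_apply _ _ x)
      (Module.Flat.rTensor_exact _ (hPn _)) (Module.Flat.rTensor_exact _ (hPn _))
      (lTensor_exact _ hιε hε) (lTensor_exact _ hιε hε)
      (Module.Flat.lTensor_preserves_injective_linearMap _ Subtype.val_injective)
      (LinearMap.lTensor_surjective _ hε) (LinearMap.lTensor_surjective _ hε)
    have hinj : Function.Injective (ι.lTensor (P n)) :=
      Module.Flat.lTensor_preserves_injective_linearMap _ Subtype.val_injective
    let e₂ := MiddleHomology.congr ((dP (n + 1)).rTensor L)
      (ι.lTensor (P n) ∘ₗ (dP n).rTensor L) ((dP (n + 1)).rTensor L) ((dP n).rTensor L)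
      (LinearEquiv.refl A _) (fun y => (map_eq_zero_iff _ hinj)) (fun y => Iff.rfl)
    exact ⟨t ≪≫ₗ e₁ ≪≫ₗ e₂ ≪≫ₗ t'.symm ≪≫ₗ s⟩

/-- The integers `t + 1 + n`, written so that successors agree definitionally. -/
def shiftIndex (t : ℤ) : ℕ → ℤ
  | 0 => t + 1
  | n + 1 => shiftIndex t n + 1

lemma shiftIndex_eq (t : ℤ) (n : ℕ) : shiftIndex t n = t + 1 + n := by
  induction n with
  | zero => simp [shiftIndex]
  | succ n ih => rw [shiftIndex, ih]; push_cast; ring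

lemma subsingleton_torModule_of_neg (N : Type u) [AddCommGroup N] [Module A N] {i : ℤ}
    (hi : i < 0) : Subsingleton (torModule A M N i) := by
  match i, hi with
  | Int.negSucc n, _ => exact inferInstanceAs (Subsingleton PUnit)

/-- `Tor` is computed by integer-indexed flat resolutions that start in an arbitrary degree. -/
theorem nonempty_torModule_equiv_of_shifted_flat_resolution
    (N : Type u) [AddCommGroup N] [Module A N] (t b : ℤ) (hb : t + 1 = b) (C : ℤ → Type u)
    [∀ i, AddCommGroup (C i)] [∀ i, Module A (C i)] [∀ i, Module.Flat A (C i)]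
    (d : ∀ i, C (i + 1) →ₗ[A] C i) (ε : C b →ₗ[A] N)
    (hC : ∀ i < b, Subsingleton (C i)) (hε : Function.Surjective ε)
    (h0 : Function.Exact (d b) ε)
    (hd : ∀ i, b ≤ i → Function.Exact (d (i + 1)) (d i)) (k : ℤ) :
    Nonempty (torModule A M N (k - t) ≃ₗ[A]
      MiddleHomology ((d (k + 1)).lTensor M) ((d k).lTensor M)) := by
  -- The homology taken here sits in degree `k + 1` and the resolution starts in degree `t + 1`,
  -- whence the Tor index `k - t`.
  subst hb
  rcases lt_trichotomy k t with h | rfl | h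
  · have := hC (k + 1) (by omega)
    have : Subsingleton (torModule A M N (k - t)) :=
      subsingleton_torModule_of_neg A M N (by omega)
    have : Subsingleton (MiddleHomology ((d (k + 1)).lTensor M) ((d k).lTensor M)) :=
      (Submodule.mkQ_surjective _).subsingleton
    exact ⟨LinearEquiv.ofSubsingleton _ _⟩
  · rw [sub_self]
    have := hC k (by omega)
    refine ⟨torZeroEquiv A M N ≪≫ₗ LinearEquiv.ofSurjectiveOfKerEq
      (G := LinearMap.ker ((d k).lTensor M)) (ε.lTensor M ∘ₗ Submodule.subtype _)
      (MiddleHomology.π _ _) ?_ (Submodule.mkQ_surjective _) ?_⟩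
    · intro x
      obtain ⟨y, rfl⟩ := LinearMap.lTensor_surjective M hε x
      exact ⟨⟨y, Subsingleton.elim _ _⟩, rfl⟩
    · rintro ⟨x, hx⟩
      exact (lTensor_exact M h0 hε x).trans (MiddleHomology.mk_eq_zero _ _ x hx).symm
  · obtain ⟨n, hn⟩ : ∃ n, k = shiftIndex t n :=
      ⟨(k - t - 1).toNat, by rw [shiftIndex_eq]; omega⟩
    subst hn
    obtain ⟨e⟩ := nonempty_torModule_equiv_of_flat_resolution A M n N
      (fun n => C (shiftIndex t n)) (fun n => d (shiftIndex t n)) ε hε h0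
      (fun n => hd _ (by rw [shiftIndex_eq]; omega))
    have : shiftIndex t n - t = ((n + 1 : ℕ) : ℤ) := by rw [shiftIndex_eq]; push_cast; ring
    rw [this]
    exact ⟨e⟩

end Balance

/-! ### Extending chain maps and homotopies from projective complexes -/

section Lifting

variable {A : Type*} [CommRing A]

/-- Maps from a projective module lift along a map whose image contains theirs. -/
lemma Module.exists_lift_of_forall_exists {P X Y : Type*} [AddCommGroup P] [Module A P]
    [Module.Projective A P] [AddCommGroup X] [Module A X] [AddCommGroup Y] [Module A Y]
    (g : X →ₗ[A] Y) (f : P →ₗ[A] Y) (h : ∀ p, ∃ x, g x = f p) :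
    ∃ l : P →ₗ[A] X, ∀ p, g (l p) = f p := by
  obtain ⟨l, hl⟩ := Module.projective_lifting_property g.rangeRestrict
    (f.codRestrict (LinearMap.range g) h) g.surjective_rangeRestrict
  exact ⟨l, fun p => congrArg Subtype.val (LinearMap.congr_fun hl p)⟩

/-- A family given at successors extends to all integers. -/
lemma exists_family_of_succ {β : ℤ → Type*} (h : ∀ k, β (k + 1)) :
    ∃ z : ∀ i, β i, ∀ k, z (k + 1) = h k := by
  -- Each integer is a successor, but not definitionally; heterogeneous equality absorbs the change
  -- of type.
  have : ∀ i, ∃ b : β i, ∀ k, i = k + 1 → HEq b (h k) := fun i => by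
    obtain ⟨k, rfl⟩ : ∃ k, i = k + 1 := ⟨i - 1, by ring⟩
    exact ⟨h k, fun l hl => by obtain rfl : k = l := by omega
                               rfl⟩
  choose z hz using this
  exact ⟨z, fun k => eq_of_heq (hz _ k rfl)⟩

/-- A homotopy given in degrees `≤ t` extends to all degrees if the source is projective and the
target is exact above `t + 1`. -/
theorem exists_homotopy_extension (t : ℤ) (F D : ℤ → Type*)
    [∀ i, AddCommGroup (F i)] [∀ i, Module A (F i)] [∀ i, Module.Projective A (F i)]
    [∀ i, AddCommGroup (D i)] [∀ i, Module A (D i)]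
    (dF : ∀ i, F (i + 1) →ₗ[A] F i) (dD : ∀ i, D (i + 1) →ₗ[A] D i) (u : ∀ i, F i →ₗ[A] D i)
    (hF : ∀ i x, dF i (dF (i + 1) x) = 0)
    (hD : ∀ i, t < i → ∀ x, dD i x = 0 → ∃ y, dD (i + 1) y = x)
    (hu : ∀ i, t < i → ∀ x, dD i (u (i + 1) x) = u i (dF i x))
    (s : ∀ i, F i →ₗ[A] D (i + 1)) (hs : ∀ x, ∃ y, dD (t + 1) y = u (t + 1) x - s t (dF t x)) :
    ∃ h : ∀ i, F i →ₗ[A] D (i + 1), (∀ i ≤ t, h i = s i) ∧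
      ∀ i, t ≤ i → ∀ x, dD (i + 1) (h (i + 1) x) + h i (dF i x) = u (i + 1) x := by
  obtain ⟨l₀, hl₀⟩ := Module.exists_lift_of_forall_exists (dD (t + 1))
    (u (t + 1) - s t ∘ₗ dF t) hs
  have step : ∀ (i : ℤ), t < i → ∀ l : F i →ₗ[A] D (i + 1),
      (∀ x, dD i (l (dF i x)) = u i (dF i x)) → ∃ l' : F (i + 1) →ₗ[A] D (i + 1 + 1),
        (∀ x, dD (i + 1) (l' (dF (i + 1) x)) = u (i + 1) (dF (i + 1) x)) ∧
        ∀ x, dD (i + 1) (l' x) + l (dF i x) = u (i + 1) x := by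
    intro i hi l hl
    obtain ⟨l', hl'⟩ := Module.exists_lift_of_forall_exists (dD (i + 1))
      (u (i + 1) - l ∘ₗ dF i) (fun x => hD i hi _ (by
        rw [LinearMap.sub_apply, map_sub, LinearMap.comp_apply, hl, hu i hi, sub_self]))
    refine ⟨l', fun x => ?_, fun x => ?_⟩
    · rw [hl', LinearMap.sub_apply, LinearMap.comp_apply, hF i x, map_zero, sub_zero]
    · rw [hl' x, LinearMap.sub_apply, LinearMap.comp_apply, sub_add_cancel]
  choose! next hnext hnext' using step
  have hlt : ∀ n, t < shiftIndex t n := fun n => by rw [shiftIndex_eq]; omega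
  -- The recursion carries the identity that makes the next lifting problem solvable.
  let T : ℕ → Type _ := fun n => {l : F (shiftIndex t n) →ₗ[A] D (shiftIndex t n + 1) //
    ∀ x, dD _ (l (dF _ x)) = u _ (dF _ x)}
  let L : ∀ n, T n := fun n => Nat.rec (motive := T)
    ⟨l₀, fun x => by
      change dD (t + 1) (l₀ (dF (t + 1) x)) = u (t + 1) (dF (t + 1) x)
      rw [hl₀, LinearMap.sub_apply, LinearMap.comp_apply, hF t x, map_zero, sub_zero]⟩
    (fun n l => ⟨next _ l.1, hnext _ (hlt n) l.1 l.2⟩) n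
  have hall : ∀ i, ∃ l : F i →ₗ[A] D (i + 1),
      (∀ n, i = shiftIndex t n → HEq l (L n).1) ∧ (i ≤ t → l = s i) := fun i => by
    by_cases hi : i ≤ t
    · exact ⟨s i, fun n hn => absurd (hlt n) (by omega), fun _ => rfl⟩
    · obtain ⟨n, rfl⟩ : ∃ n, i = shiftIndex t n :=
        ⟨(i - t - 1).toNat, by rw [shiftIndex_eq]; omega⟩
      refine ⟨(L n).1, fun m hm => ?_, fun h => absurd h hi⟩
      obtain rfl : n = m := by simp only [shiftIndex_eq] at hm; omega
      rfl
  choose h hL hs' using hall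
  have hL' : ∀ n, h (shiftIndex t n) = (L n).1 := fun n => eq_of_heq (hL _ n rfl)
  refine ⟨h, hs', fun i hi x => ?_⟩
  rcases hi.eq_or_lt with rfl | hi
  · have h1 : h (t + 1) = l₀ := hL' 0
    rw [h1, hs' t le_rfl, hl₀, LinearMap.sub_apply, LinearMap.comp_apply, sub_add_cancel]
  · obtain ⟨n, rfl⟩ : ∃ n, i = shiftIndex t n :=
      ⟨(i - t - 1).toNat, by rw [shiftIndex_eq]; omega⟩
    have h1 : h (shiftIndex t n + 1) = next _ (L n).1 := hL' (n + 1)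
    rw [h1, hL' n, hnext' _ (hlt n) _ (L n).2]

end Lifting

section Extend

variable (A : Type u) [CommRing A]

/-- Extension of a family indexed by `ℕ` to `ℤ` by zero. -/
def extendByZero (P : ℕ → ModuleCat.{u} A) : ℤ → ModuleCat.{u} A
  | Int.ofNat n => P n
  | Int.negSucc _ => ModuleCat.of A PUnit

/-- The differential of the extension by zero. -/
def extendByZeroD (P : ℕ → ModuleCat.{u} A) (d : ∀ n, P (n + 1) →ₗ[A] P n) :
    ∀ i : ℤ, extendByZero A P (i + 1) →ₗ[A] extendByZero A P i
  | Int.ofNat n => d n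
  | Int.negSucc _ => 0

/-- Every module has a projective resolution indexed by the integers. -/
theorem exists_int_projective_resolution (N : Type u) [AddCommGroup N] [Module A N]
    (b : ℤ) (hb : b = 0) :
    ∃ (P : ℤ → ModuleCat.{u} A) (d : ∀ i, P (i + 1) →ₗ[A] P i) (ε : P b →ₗ[A] N),
      (∀ i, Module.Projective A (P i)) ∧ (∀ i < b, Subsingleton (P i)) ∧
      Function.Surjective ε ∧ Function.Exact (d b) ε ∧
      (∀ i, b ≤ i → Function.Exact (d (i + 1)) (d i)) ∧ (∀ i x, d i (d (i + 1) x) = 0) := by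
  subst hb
  obtain ⟨P, d, ε, hP, hε, h0, hn, -⟩ := exists_projective_resolution_tor A N
  have hsub : ∀ i < 0, Subsingleton (extendByZero A P i) := fun i hi => by
    match i, hi with
    | Int.negSucc n, _ => exact inferInstanceAs (Subsingleton PUnit)
  have hex : ∀ i, 0 ≤ i →
      Function.Exact (extendByZeroD A P d (i + 1)) (extendByZeroD A P d i) := fun i hi => by
    match i, hi with
    | Int.ofNat n, _ => exact hn n
  refine ⟨extendByZero A P, extendByZeroD A P d, ε, fun i => ?_, hsub, hε, h0, hex, ?_⟩
  · match i with
    | Int.ofNat n => exact hP n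
    | Int.negSucc n => exact inferInstanceAs (Module.Projective A PUnit.{u + 1})
  · intro i x
    rcases lt_or_ge i 0 with hi | hi
    · have := hsub i hi
      exact Subsingleton.elim _ _
    · exact (hex i hi).apply_apply_eq_zero x

end Extend

section Lifting

variable {A : Type*} [CommRing A]

/-- A chain map from a projective complex in nonnegative degrees to an exact complex is
null-homotopic if it is zero on homology in degree zero. -/
theorem exists_null_homotopy (F D : ℤ → Type*)
    [∀ i, AddCommGroup (F i)] [∀ i, Module A (F i)] [∀ i, Module.Projective A (F i)]
    [∀ i, AddCommGroup (D i)] [∀ i, Module A (D i)]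
    (dF : ∀ i, F (i + 1) →ₗ[A] F i) (dD : ∀ i, D (i + 1) →ₗ[A] D i) (u : ∀ i, F i →ₗ[A] D i)
    (hF : ∀ i x, dF i (dF (i + 1) x) = 0) (hneg : ∀ i < 0, Subsingleton (F i))
    (hD : ∀ i, 0 ≤ i → ∀ x, dD i x = 0 → ∃ y, dD (i + 1) y = x)
    (hu : ∀ i, 0 ≤ i → ∀ x, dD i (u (i + 1) x) = u i (dF i x))
    (hu0 : ∀ x, ∃ y, dD 0 y = u 0 x) :
    ∃ h : ∀ i, F i →ₗ[A] D (i + 1), (∀ x, dD 0 (h 0 x) = u 0 x) ∧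
      ∀ i x, dD (i + 1) (h (i + 1) x) + h i (dF i x) = u (i + 1) x := by
  have hu0' : ∀ j, j = 0 → ∀ x, ∃ y, dD j y = u j x := by
    rintro j rfl; exact hu0
  obtain ⟨h, h0, hh⟩ := exists_homotopy_extension (-1) F D dF dD u hF
    (fun i hi => hD i (by omega)) (fun i hi => hu i (by omega)) 0
    (by simpa using hu0' (-1 + 1) (by norm_num))
  have key : ∀ j, j = 0 → ∀ x, dD j (h j x) = u j x := by
    intro j hj x
    obtain ⟨i, rfl⟩ : ∃ i, j = i + 1 := ⟨j - 1, by ring⟩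
    have := hh i (by omega) x
    rwa [h0 i (by omega), Pi.zero_apply, LinearMap.zero_apply, add_zero] at this
  refine ⟨h, key 0 rfl, fun i x => ?_⟩
  by_cases hi : -1 ≤ i
  · exact hh i hi x
  · have := hneg (i + 1) (by omega)
    rw [Subsingleton.elim x 0]; simp

end Lifting

/-! ### The periodicity operator and its composite with the connecting map -/

/-- A resolution `F` together with homotopies `X`, `T` for multiplication by `f` and `g`, and
a homotopy `Y` for `g X`. -/
structure HomotopyOperators {Q : Type*} [CommRing Q] (f g : Q) (F : ℤ → Type*)
    [∀ i, AddCommGroup (F i)] [∀ i, Module Q (F i)] where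
  d : ∀ i, F (i + 1) →ₗ[Q] F i
  d_d : ∀ i x, d i (d (i + 1) x) = 0
  exact : ∀ i, 0 ≤ i → ∀ x, d i x = 0 → ∃ y, d (i + 1) y = x
  neg : ∀ i < 0, Subsingleton (F i)
  fg : f * g = 0
  ann_f : ∀ i (x : F i), f • x = 0 → ∃ y : F i, g • y = x
  ann_g : ∀ i (x : F i), g • x = 0 → ∃ y : F i, f • y = x
  g_zero : ∀ x : F 0, ∃ y, d 0 y = g • x
  X : ∀ i, F i →ₗ[Q] F (i + 1)
  T : ∀ i, F i →ₗ[Q] F (i + 1)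
  Y : ∀ i, F i →ₗ[Q] F (i + 1 + 1)
  d_X_zero : ∀ x, d 0 (X 0 x) = f • x
  d_X : ∀ i x, d (i + 1) (X (i + 1) x) + X i (d i x) = f • x
  d_T : ∀ i x, d (i + 1) (T (i + 1) x) + T i (d i x) = g • x
  d_Y : ∀ i x, d (i + 1 + 1) (Y (i + 1) x) - Y i (d i x) = g • X (i + 1) x

/-- Homotopy operators exist on every projective resolution of a module killed by `f` and `g`. -/
theorem nonempty_homotopyOperators {Q : Type*} [CommRing Q] (f g : Q) (F : ℤ → Type*)
    [∀ i, AddCommGroup (F i)] [∀ i, Module Q (F i)] [∀ i, Module.Projective Q (F i)]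
    (d : ∀ i, F (i + 1) →ₗ[Q] F i) (d_d : ∀ i x, d i (d (i + 1) x) = 0)
    (exact : ∀ i, 0 ≤ i → ∀ x, d i x = 0 → ∃ y, d (i + 1) y = x)
    (neg : ∀ i < 0, Subsingleton (F i)) (fg : f * g = 0)
    (ann_f : ∀ i (x : F i), f • x = 0 → ∃ y : F i, g • y = x)
    (ann_g : ∀ i (x : F i), g • x = 0 → ∃ y : F i, f • y = x)
    (f_zero : ∀ x : F 0, ∃ y, d 0 y = f • x) (g_zero : ∀ x : F 0, ∃ y, d 0 y = g • x) :
    ∃ H : HomotopyOperators f g F, H.d = d := by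
  obtain ⟨X, hX0, hX⟩ := exists_null_homotopy F F d d (fun i => LinearMap.lsmul Q (F i) f)
    d_d neg exact (fun i _ x => by simp) (by simpa using f_zero)
  obtain ⟨T, hT0, hT⟩ := exists_null_homotopy F F d d (fun i => LinearMap.lsmul Q (F i) g)
    d_d neg exact (fun i _ x => by simp) (by simpa using g_zero)
  simp only [LinearMap.lsmul_apply] at hX0 hX hT0 hT
  have hgf : ∀ i (x : F i), g • f • x = 0 := fun i x => by
    rw [smul_smul, mul_comm, fg, zero_smul]
  -- As `g f = 0`, the map `g X` anticommutes with `d`; with the differential of the shifted target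
  -- negated it becomes a chain map.
  obtain ⟨Y, -, hY⟩ := exists_null_homotopy F (fun i => F (i + 1)) d (fun i => -d (i + 1))
    (fun i => g • X i) d_d neg
    (fun i hi x hx => by
      obtain ⟨y, hy⟩ := exact (i + 1) (by omega) x (by simpa using hx)
      exact ⟨-y, by simpa using hy⟩)
    (fun i _ x => by
      have h := congrArg (g • ·) (hX i x)
      simp only [smul_add, hgf] at h
      simpa [neg_eq_iff_add_eq_zero] using h)
    (fun x => by
      obtain ⟨y, hy⟩ := exact 0 le_rfl (g • X 0 x) (by rw [map_smul, hX0, hgf])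
      exact ⟨-y, by simpa using hy⟩)
  exact ⟨⟨d, d_d, exact, neg, fg, ann_f, ann_g, g_zero, X, T, fun i => -Y i, hX0, hX, hT,
    fun i x => by
      have := hY i x
      simp only [LinearMap.neg_apply, LinearMap.smul_apply, map_neg] at this ⊢
      rw [← this]; abel⟩, rfl⟩

namespace HomotopyOperators

variable {Q : Type*} [CommRing Q] {f g : Q} {F : ℤ → Type*}
  [∀ i, AddCommGroup (F i)] [∀ i, Module Q (F i)] (H : HomotopyOperators f g F)

/-- Boundaries modulo `f`. -/
def bd (i : ℤ) : Submodule Q (F i) :=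
  LinearMap.range (H.d i) ⊔ LinearMap.range (LinearMap.lsmul Q (F i) f)

lemma mem_bd {i : ℤ} {x : F i} : x ∈ H.bd i ↔ ∃ p q, H.d i p + f • q = x := by
  unfold bd
  rw [Submodule.mem_sup]
  constructor
  · rintro ⟨_, ⟨p, rfl⟩, _, ⟨q, rfl⟩, h⟩
    exact ⟨p, q, h⟩
  · rintro ⟨p, q, h⟩
    exact ⟨_, ⟨p, rfl⟩, _, ⟨q, rfl⟩, h⟩

lemma f_g_smul (H : HomotopyOperators f g F) {i : ℤ} (x : F i) : f • g • x = 0 := by rw [smul_smul, H.fg, zero_smul]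

lemma g_f_smul (H : HomotopyOperators f g F) {i : ℤ} (x : F i) : g • f • x = 0 := by rw [smul_comm, H.f_g_smul]

/-- The periodicity operator, of degree two. -/
def y (i : ℤ) : F i →ₗ[Q] F (i + 1 + 1) := H.Y i - H.T (i + 1) ∘ₗ H.X i

lemma y_apply (i : ℤ) (x : F i) : H.y i x = H.Y i x - H.T (i + 1) (H.X i x) := rfl

/-- The terms `g X` from `Y` and from `T X` cancel. What survives is `T` applied to `d X + X d = f`,
so `y` is a chain map modulo `f`. -/
lemma d_y (i : ℤ) (x : F (i + 1)) :
    H.d (i + 1 + 1) (H.y (i + 1) x) = H.y i (H.d i x) + f • H.T (i + 1) x := by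
  have h1 := H.d_Y i x
  have h2 := H.d_T (i + 1) (H.X (i + 1) x)
  have h3 := congrArg (H.T (i + 1)) (H.d_X i x)
  simp only [map_add, map_smul] at h3
  rw [y_apply, y_apply, map_sub, ← h3, sub_eq_iff_eq_add.1 h1, ← h2]
  abel

/-- The zigzag Δ from `c` to `a` exists because `d b` is killed by `f`; dually, `exists_next'` shows
that its end is again a cycle modulo `f`. -/
lemma exists_next {i : ℤ} {c : F (i + 1 + 1)} {b : F (i + 1)} (h : H.d (i + 1) c = f • b) :
    ∃ a, H.d i b = g • a := by
  obtain ⟨a, ha⟩ := H.ann_f i (H.d i b) (by rw [← map_smul, ← h, H.d_d])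
  exact ⟨a, ha.symm⟩

lemma exists_next' {i : ℤ} {b : F (i + 1 + 1)} {a : F (i + 1)} (h : H.d (i + 1) b = g • a) :
    ∃ e, H.d i a = f • e := by
  obtain ⟨a, ha⟩ := H.ann_g i (H.d i a) (by rw [← map_smul, ← h, H.d_d])
  exact ⟨a, ha.symm⟩

/-- Δ is well defined on homology: if `c = d t + f r`, then `b - d r` is killed by `f`, hence equals
some `g p`, and `a - d p` is killed by `g`. -/
lemma mem_bd_of_mem_bd {i : ℤ} {c : F (i + 1 + 1)} {b : F (i + 1)} {a : F i}
    (h : H.d (i + 1) c = f • b) (h' : H.d i b = g • a) (hc : c ∈ H.bd _) : a ∈ H.bd _ := by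
  obtain ⟨t, r, rfl⟩ := H.mem_bd.1 hc
  rw [map_add, H.d_d, zero_add, map_smul] at h
  obtain ⟨p, hp⟩ := H.ann_f _ (b - H.d (i + 1) r) (by rw [smul_sub, h, sub_self])
  obtain ⟨q, hq⟩ := H.ann_g _ (a - H.d i p) (by
    rw [smul_sub, ← h', ← map_smul, hp, map_sub, H.d_d, sub_zero, sub_self])
  exact H.mem_bd.2 ⟨p, q, by rw [hq]; abel⟩

/-- Injectivity of Δ, from exactness of `F` used twice: if `a = d p + f q`, then `b - g p` is a
boundary `d r`, and `c - f r` is a cycle. -/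
lemma mem_bd_of_mem_bd' {i : ℤ} (hi : 0 ≤ i) {c : F (i + 1 + 1)} {b : F (i + 1)} {a : F i}
    (h : H.d (i + 1) c = f • b) (h' : H.d i b = g • a) (ha : a ∈ H.bd _) : c ∈ H.bd _ := by
  obtain ⟨p, q, rfl⟩ := H.mem_bd.1 ha
  obtain ⟨r, hr⟩ := H.exact i hi (b - g • p) (by
    rw [map_sub, h', map_smul, smul_add, H.g_f_smul, add_zero, sub_self])
  obtain ⟨t, ht⟩ := H.exact (i + 1) (by omega) (c - f • r) (by
    rw [map_sub, h, map_smul, hr, smul_sub, H.f_g_smul, sub_zero, sub_self])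
  exact H.mem_bd.2 ⟨t, r, by rw [ht]; abel⟩

lemma d_y_cycle {i : ℤ} {a : F (i + 1)} {e : F i} (h : H.d i a = f • e) :
    H.d (i + 1 + 1) (H.y (i + 1) a) = f • (H.y i e + H.T (i + 1) a) := by
  rw [d_y, h, map_smul, smul_add]

/-- Together with `d_y_cycle` this is the identity Δ(y a) = a + y(Δ a), with Δ a represented by
`e'`. -/
lemma d_y_cycle' {i : ℤ} {a : F (i + 1 + 1)} {e : F (i + 1)} {e' : F i}
    (h : H.d (i + 1) a = f • e) (h' : H.d i e = g • e') :
    H.d (i + 1 + 1) (H.y (i + 1) e + H.T (i + 1 + 1) a) = g • (a + H.y i e') := by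
  have h1 := H.d_T (i + 1) a
  rw [h, map_smul] at h1
  rw [map_add, d_y, h', map_smul, smul_add, ← h1]
  abel

/-- The connecting operator composed with `y` is a positive integer modulo boundaries. -/
theorem exists_nat_connecting_y (i : ℤ) : ∃ j : ℕ, 0 < j ∧
    ∀ (a : F (i + 1 + 1)) (e : F (i + 1)), H.d (i + 1) a = f • e →
    ∀ (b : F (i + 1 + 1 + 1)) (a' : F (i + 1 + 1)),
      H.d (i + 1 + 1 + 1) (H.y (i + 1 + 1) a) = f • b → H.d (i + 1 + 1) b = g • a' →
      a' - (j : Q) • a ∈ H.bd (i + 1 + 1) := by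
  have reduce : ∀ (i : ℤ) (a : F (i + 1 + 1)) (e : F (i + 1)) (e' : F i),
      H.d (i + 1) a = f • e → H.d i e = g • e' →
      ∀ (b : F (i + 1 + 1 + 1)) (a' : F (i + 1 + 1)),
      H.d (i + 1 + 1 + 1) (H.y (i + 1 + 1) a) = f • b → H.d (i + 1 + 1) b = g • a' →
      a' - (a + H.y i e') ∈ H.bd (i + 1 + 1) := by
    intro i a e e' h h' b a' hb ha'
    refine H.mem_bd_of_mem_bd (c := 0) (b := b - (H.y (i + 1) e + H.T (i + 1 + 1) a)) ?_ ?_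
      (zero_mem _)
    · rw [map_zero, smul_sub, ← hb, H.d_y_cycle h, sub_self]
    · rw [map_sub, ha', H.d_y_cycle' h h', smul_sub]
  -- Here Δ a lies in a zero module, so Δ(y a) = a and the integer is one.
  have base : ∀ i < 0, ∃ j : ℕ, 0 < j ∧
      ∀ (a : F (i + 1 + 1)) (e : F (i + 1)), H.d (i + 1) a = f • e →
      ∀ (b : F (i + 1 + 1 + 1)) (a' : F (i + 1 + 1)),
      H.d (i + 1 + 1 + 1) (H.y (i + 1 + 1) a) = f • b → H.d (i + 1 + 1) b = g • a' →
      a' - (j : Q) • a ∈ H.bd (i + 1 + 1) := by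
    intro i hi
    refine ⟨1, one_pos, fun a e h b a' hb ha' => ?_⟩
    have := H.neg i hi
    have key := reduce i a e 0 h (Subsingleton.elim _ _) b a' hb ha'
    simpa using key
  suffices ∀ (n : ℕ) (i : ℤ), i < n → ∃ j : ℕ, 0 < j ∧
      ∀ (a : F (i + 1 + 1)) (e : F (i + 1)), H.d (i + 1) a = f • e →
      ∀ (b : F (i + 1 + 1 + 1)) (a' : F (i + 1 + 1)),
      H.d (i + 1 + 1 + 1) (H.y (i + 1 + 1) a) = f • b → H.d (i + 1 + 1) b = g • a' →
      a' - (j : Q) • a ∈ H.bd (i + 1 + 1) from this (i.toNat + 1) i (by omega)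
  intro n
  induction n with
  | zero => exact fun i hi => base i (by simpa using hi)
  | succ n ih =>
    intro i hi
    rcases lt_or_ge i 0 with h0 | h0
    · exact base i h0
    obtain ⟨k, rfl⟩ : ∃ k, i = k + 1 + 1 := ⟨i - 2, by ring⟩
    obtain ⟨j, -, hj⟩ := ih k (by push_cast at hi; omega)
    refine ⟨j + 1, j.succ_pos, fun a e h b a' hb ha' => ?_⟩
    obtain ⟨e', he'⟩ := H.exists_next h
    obtain ⟨e'', he''⟩ := H.exists_next' he'
    have hc := H.d_y_cycle he''
    obtain ⟨a₁, ha₁⟩ := H.exists_next hc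
    have h1 := hj e' e'' he'' _ a₁ hc ha₁
    -- By induction Δ sends `y e'` to `j e'`, which is also Δ of `j a`. Injectivity of Δ gives `y e'
    -- = j a` on homology, so Δ(y a) = (j + 1) a.
    have h2 : H.y (k + 1 + 1) e' - (j : Q) • a ∈ H.bd _ := by
      refine H.mem_bd_of_mem_bd' h0
        (b := (H.y (k + 1) e'' + H.T (k + 1 + 1) e') - (j : Q) • e) ?_ ?_ h1
      · rw [map_sub, hc, map_smul, h, smul_sub, smul_comm]
      · rw [map_sub, ha₁, map_smul, he', smul_sub, smul_comm]
    have h3 := add_mem (reduce _ a e e' h he' b a' hb ha') h2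
    have : a' - ((j + 1 : ℕ) : Q) • a =
        a' - (a + H.y (k + 1 + 1) e') + (H.y (k + 1 + 1) e' - (j : Q) • a) := by
      push_cast
      rw [add_smul, one_smul]; abel
    rw [this]; exact h3

/-- The periodicity operator is injective on homology. -/
theorem mem_bd_of_y_mem_bd (hQ : ∀ j : ℕ, 0 < j → ∃ v : Q, v * j = 1) {i : ℤ}
    {a : F (i + 1 + 1)} {e : F (i + 1)} (h : H.d (i + 1) a = f • e)
    (hy : H.y (i + 1 + 1) a ∈ H.bd _) : a ∈ H.bd _ := by
  obtain ⟨j, hj, hja⟩ := H.exists_nat_connecting_y i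
  obtain ⟨v, hv⟩ := hQ j hj
  have hc := H.d_y_cycle h
  obtain ⟨a', ha'⟩ := H.exists_next hc
  have h1 := sub_mem (H.mem_bd_of_mem_bd hc ha' hy) (hja a e h _ a' hc ha')
  rw [sub_sub_cancel] at h1
  simpa [smul_smul, hv] using Submodule.smul_mem _ v h1

/-- The periodicity operator is surjective onto homology in degrees at least two. -/
theorem exists_sub_y_mem_bd (hQ : ∀ j : ℕ, 0 < j → ∃ v : Q, v * j = 1) {i : ℤ}
    (hi : 0 ≤ i + 1 + 1) {c : F (i + 1 + 1 + 1 + 1)} {b : F (i + 1 + 1 + 1)}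
    (h : H.d (i + 1 + 1 + 1) c = f • b) :
    ∃ (a : F (i + 1 + 1)) (e : F (i + 1)), H.d (i + 1) a = f • e ∧
      c - H.y (i + 1 + 1) a ∈ H.bd _ := by
  obtain ⟨j, hj, hja⟩ := H.exists_nat_connecting_y i
  obtain ⟨v, hv⟩ := hQ j hj
  obtain ⟨a', ha'⟩ := H.exists_next h
  obtain ⟨e', he'⟩ := H.exists_next' ha'
  -- The preimage is Δ c divided by `j`: then `c` and its image under `y` agree after Δ, hence on
  -- homology.
  have hva : H.d (i + 1) (v • a') = f • v • e' := by rw [map_smul, he', smul_comm]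
  have hc := H.d_y_cycle hva
  obtain ⟨a₁, ha₁⟩ := H.exists_next hc
  have h1 := hja _ _ hva _ a₁ hc ha₁
  rw [smul_smul, mul_comm, hv, one_smul] at h1
  refine ⟨v • a', v • e', hva, H.mem_bd_of_mem_bd' hi (b := b - (H.y (i + 1) (v • e') +
    H.T (i + 1 + 1) (v • a'))) (a := a' - a₁) ?_ ?_ ?_⟩
  · rw [map_sub, h, hc, smul_sub]
  · rw [map_sub, ha', ha₁, smul_sub]
  · rw [← neg_sub]; exact neg_mem h1

/-- Cycles of degree one modulo `f` come from degree zero through `X`. -/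
theorem exists_sub_X_mem_bd {c : F (0 + 1)} {b : F 0} (h : H.d 0 c = f • b) :
    c - H.X 0 b ∈ H.bd _ := by
  obtain ⟨y, hy⟩ := H.exact 0 le_rfl (c - H.X 0 b) (by rw [map_sub, h, H.d_X_zero, sub_self])
  exact H.mem_bd.2 ⟨y, 0, by rw [hy, smul_zero, add_zero]⟩

/-- `X` is injective on homology in degree zero. -/
theorem exists_of_X_mem_bd {b : F 0} (h : H.X 0 b ∈ H.bd _) : ∃ x, H.d 0 x = b := by
  obtain ⟨p, q, hpq⟩ := H.mem_bd.1 h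
  have h1 := H.d_X_zero b
  rw [← hpq, map_add, H.d_d, zero_add, map_smul] at h1
  -- Since `f b = f d q`, the difference lies in `g F 0`, which consists of boundaries because `g`
  -- kills the resolved module.
  obtain ⟨r, hr⟩ := H.ann_f _ (b - H.d 0 q) (by rw [smul_sub, h1, sub_self])
  obtain ⟨s, hs⟩ := H.g_zero r
  exact ⟨s + q, by rw [map_add, hs, hr, sub_add_cancel]⟩

end HomotopyOperators

/-! ### Mapping cones and their long exact sequences -/

section Cone

variable {A : Type*} [CommRing A] {C D : ℤ → Type*}
  [∀ i, AddCommGroup (C i)] [∀ i, Module A (C i)]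
  [∀ i, AddCommGroup (D i)] [∀ i, Module A (D i)]

/-- The differential of the mapping cone of `z`, whose target is indexed so that `z` has
degree `-1`. -/
def coneD (dC : ∀ i, C (i + 1) →ₗ[A] C i) (dD : ∀ i, D (i + 1) →ₗ[A] D i)
    (z : ∀ i, D (i + 1) →ₗ[A] C i) (i : ℤ) : (C (i + 1) × D (i + 1)) →ₗ[A] C i × D i :=
  LinearMap.prod (dC i ∘ₗ LinearMap.fst A _ _ + z i ∘ₗ LinearMap.snd A _ _)
    (-(dD i ∘ₗ LinearMap.snd A _ _))

variable (dC : ∀ i, C (i + 1) →ₗ[A] C i) (dD : ∀ i, D (i + 1) →ₗ[A] D i)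
  (z : ∀ i, D (i + 1) →ₗ[A] C i)

@[simp] lemma coneD_apply (i : ℤ) (x : C (i + 1) × D (i + 1)) :
    coneD dC dD z i x = (dC i x.1 + z i x.2, -dD i x.2) := rfl

lemma coneD_coneD (hC : ∀ i x, dC i (dC (i + 1) x) = 0) (hD : ∀ i x, dD i (dD (i + 1) x) = 0)
    (hz : ∀ i x, dC i (z (i + 1) x) = z i (dD (i + 1) x)) (i : ℤ)
    (x : C (i + 1 + 1) × D (i + 1 + 1)) :
    coneD dC dD z i (coneD dC dD z (i + 1) x) = 0 := by
  ext <;> simp [hC, hD, hz]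

/-- The cone is exact where `z` is injective on one homology group and surjective on the next. -/
lemma coneD_exact (hz : ∀ i x, dC i (z (i + 1) x) = z i (dD (i + 1) x)) (i : ℤ)
    (h1 : ∀ x, dD i x = 0 → (∃ c, dC i c = z i x) → ∃ x', dD (i + 1) x' = x)
    (h2 : ∀ c, dC i c = 0 → ∃ c' x', dD (i + 1) x' = 0 ∧ dC (i + 1) c' + z (i + 1) x' = c)
    (k : C (i + 1) × D (i + 1)) (hk : coneD dC dD z i k = 0) :
    ∃ k', coneD dC dD z (i + 1) k' = k := by
  obtain ⟨c, x⟩ := k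
  simp only [coneD_apply, Prod.mk_eq_zero, neg_eq_zero] at hk
  obtain ⟨x', rfl⟩ := h1 x hk.2 ⟨-c, by rw [map_neg, neg_eq_of_add_eq_zero_right hk.1]⟩
  obtain ⟨c', x'', hx'', hc'⟩ := h2 (c + z (i + 1) x') (by rw [map_add, hz, hk.1])
  refine ⟨(c', x'' - x'), ?_⟩
  ext
  · simp only [coneD_apply, map_sub]
    rw [← add_sub_assoc, hc', add_sub_cancel_right]
  · simp [hx'']

namespace MiddleHomology

/-- Inclusion of the target of `z` in the cone, on homology. -/
def coneInl (k : ℤ) : MiddleHomology (dC (k + 1)) (dC k) →ₗ[A]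
    MiddleHomology (coneD dC dD z (k + 1)) (coneD dC dD z k) :=
  map _ _ _ _ (LinearMap.inl A _ _) (fun y hy => by simp [hy]) (fun x => ⟨(x, 0), by simp⟩)

/-- Projection of the cone to the source of `z`, on homology. -/
def coneSnd (k : ℤ) : MiddleHomology (coneD dC dD z (k + 1)) (coneD dC dD z k) →ₗ[A]
    MiddleHomology (dD (k + 1)) (dD k) :=
  map _ _ _ _ (LinearMap.snd A _ _)
    (fun y hy => by
      have := congrArg Prod.snd hy
      simpa using this)
    (fun x => ⟨-x.2, by simp⟩)

/-- The connecting map of the cone, on homology. -/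
def coneδ (hz : ∀ i x, dC i (z (i + 1) x) = z i (dD (i + 1) x)) (k : ℤ) :
    MiddleHomology (dD (k + 1 + 1)) (dD (k + 1)) →ₗ[A] MiddleHomology (dC (k + 1)) (dC k) :=
  map _ _ _ _ (z (k + 1)) (fun y hy => by rw [hz, hy, map_zero])
    (fun x => ⟨z (k + 1 + 1) x, hz _ x⟩)

variable (hz : ∀ i x, dC i (z (i + 1) x) = z i (dD (i + 1) x)) (k : ℤ)

lemma exact_coneδ_coneInl : Function.Exact (coneδ dC dD z hz k) (coneInl dC dD z k) := by
  intro c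
  obtain ⟨c, hc, rfl⟩ := mk_surjective _ _ c
  constructor
  · intro h
    obtain ⟨⟨c', x⟩, h⟩ := (mk_eq_zero _ _ _ _).1 h
    have h1 : dC (k + 1) c' + z (k + 1) x = c := congrArg Prod.fst h
    have h2 : -dD (k + 1) x = 0 := congrArg Prod.snd h
    refine ⟨mk _ _ x (neg_eq_zero.1 h2), ?_⟩
    rw [coneδ, map_mk]
    refine (sub_eq_zero.1 ((mk_eq_zero _ _ _ _).2 ⟨c', ?_⟩ :
      mk (dC (k + 1)) (dC k) (c - z (k + 1) x) (by rw [← h1]; simp [h1, hc, hz, neg_eq_zero.1 h2])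
        = 0)).symm
    rw [← h1, add_sub_cancel_right]
  · rintro ⟨x, hx⟩
    obtain ⟨x, hx', rfl⟩ := mk_surjective _ _ x
    rw [← hx]
    exact (mk_eq_zero _ _ _ _).2 ⟨(0, x), by simp [hx']; rfl⟩

lemma exact_coneInl_coneSnd (hz : ∀ i x, dC i (z (i + 1) x) = z i (dD (i + 1) x)) (k : ℤ) :
    Function.Exact (coneInl dC dD z k) (coneSnd dC dD z k) := by
  intro c
  obtain ⟨⟨c, x⟩, hc, rfl⟩ := mk_surjective _ _ c
  constructor
  · intro h
    obtain ⟨x', h⟩ := (mk_eq_zero _ _ _ _).1 h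
    change dD (k + 1) x' = x at h
    have h1 : dC k c + z k x = 0 := congrArg Prod.fst hc
    refine ⟨mk _ _ (c + z (k + 1) x') (by rw [map_add, hz, h, h1]), ?_⟩
    rw [coneInl, map_mk]
    refine sub_eq_zero.1 ((mk_eq_zero _ _ _ _).2 ⟨(0, x'), ?_⟩ : mk _ _
      ((c + z (k + 1) x', 0) - (c, x)) (by rw [map_sub, hc]; simp [hz, h, h1]) = 0)
    simp [h]
  · rintro ⟨x', hx⟩
    obtain ⟨x', hx', rfl⟩ := mk_surjective _ _ x'
    rw [← hx]
    exact (mk_eq_zero _ _ _ _).2 ⟨0, by simp; rfl⟩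

lemma exact_coneSnd_coneδ : Function.Exact (coneSnd dC dD z (k + 1)) (coneδ dC dD z hz k) := by
  intro x
  obtain ⟨x, hx, rfl⟩ := mk_surjective _ _ x
  constructor
  · intro h
    obtain ⟨c, h⟩ := (mk_eq_zero _ _ _ _).1 h
    exact ⟨mk _ _ (-c, x) (by simp [h, hx]), rfl⟩
  · rintro ⟨c, hc⟩
    obtain ⟨⟨c, x'⟩, hc', rfl⟩ := mk_surjective _ _ c
    rw [← hc]
    have h1 : dC (k + 1) c + z (k + 1) x' = 0 := congrArg Prod.fst hc'
    exact (mk_eq_zero _ _ _ _).2 ⟨-c, by rw [map_neg, neg_eq_of_add_eq_zero_right h1]; rfl⟩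

end MiddleHomology

/-- Tensoring commutes with forming cones. -/
lemma prodRight_lTensor_coneD (M : Type*) [AddCommGroup M] [Module A M] (i : ℤ)
    (x : M ⊗[A] (C (i + 1) × D (i + 1))) :
    TensorProduct.prodRight A A M (C i) (D i) ((coneD dC dD z i).lTensor M x) =
      coneD (C := fun i => M ⊗[A] C i) (D := fun i => M ⊗[A] D i) (fun i => (dC i).lTensor M) (fun i => (dD i).lTensor M)
        (fun i => (z i).lTensor M) i (TensorProduct.prodRight A A M _ _ x) := by
  induction x with
  | zero => simp; rfl
  | add x y hx hy => rw [map_add, map_add, hx, hy, map_add, map_add]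
  | tmul m x =>
    ext
    · simp [TensorProduct.tmul_add]
    · simp [TensorProduct.tmul_neg]

/-- The homology of a tensored cone is the homology of the cone of the tensored map. -/
noncomputable def MiddleHomology.coneTensorEquiv (M : Type*) [AddCommGroup M] [Module A M]
    (k : ℤ) :
    MiddleHomology ((coneD dC dD z (k + 1)).lTensor M) ((coneD dC dD z k).lTensor M) ≃ₗ[A]
      MiddleHomology
        (coneD (C := fun i => M ⊗[A] C i) (D := fun i => M ⊗[A] D i) (fun i => (dC i).lTensor M) (fun i => (dD i).lTensor M)
          (fun i => (z i).lTensor M) (k + 1))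
        (coneD (C := fun i => M ⊗[A] C i) (D := fun i => M ⊗[A] D i) (fun i => (dC i).lTensor M) (fun i => (dD i).lTensor M)
          (fun i => (z i).lTensor M) k) :=
  MiddleHomology.congr _ _ _ _ (TensorProduct.prodRight A A M _ _)
    (fun y => by
      rw [← prodRight_lTensor_coneD, LinearEquiv.map_eq_zero_iff])
    (fun y => by
      constructor
      · rintro ⟨x, rfl⟩
        exact ⟨_, (prodRight_lTensor_coneD dC dD z M (k + 1) x).symm⟩
      · rintro ⟨x, hx⟩
        obtain ⟨x, rfl⟩ := (TensorProduct.prodRight A A M _ _).surjective x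
        refine ⟨x, (TensorProduct.prodRight A A M _ _).injective ?_⟩
        rw [prodRight_lTensor_coneD, hx])

end Cone

/-! ### Flat modules and reduction modulo `f` -/

/-- If `ann(f) = (g)`, the same holds on every flat module. -/
lemma Module.Flat.exists_smul_eq_of_smul_eq_zero {Q : Type*} [CommRing Q] {f g : Q}
    (h : ∀ x : Q, x * f = 0 ↔ x ∈ Ideal.span {g}) {P : Type*} [AddCommGroup P] [Module Q P]
    [Module.Flat Q P] {x : P} (hx : f • x = 0) : ∃ y : P, g • y = x := by
  -- The annihilator condition is exactness of `Q → Q → Q` with maps `g`, `f`, which is preserved by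
  -- tensoring with a flat module.
  have hex : Function.Exact (LinearMap.lsmul Q Q g) (LinearMap.lsmul Q Q f) := fun x => by
    rw [LinearMap.lsmul_apply, smul_eq_mul, mul_comm, h, Ideal.mem_span_singleton']
    exact exists_congr fun a => by rw [LinearMap.lsmul_apply, smul_eq_mul, mul_comm]
  obtain ⟨t, ht⟩ := (Module.Flat.lTensor_exact P hex (x ⊗ₜ[Q] 1)).1 (by
    rw [LinearMap.lTensor_tmul, LinearMap.lsmul_apply, TensorProduct.tmul_smul,
      TensorProduct.smul_tmul', hx, TensorProduct.zero_tmul])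
  refine ⟨TensorProduct.rid Q P t, ?_⟩
  have key : ∀ t, TensorProduct.rid Q P ((LinearMap.lsmul Q Q g).lTensor P t) =
      g • TensorProduct.rid Q P t := by
    intro t
    induction t with
    | zero => simp
    | add x y hx hy => rw [map_add, map_add, hx, hy, map_add, smul_add]
    | tmul p q => simp [smul_smul]
  rw [← key, ht]
  simp

section Reduction

variable {Q : Type*} [CommRing Q] (f : Q)

/-- Reduction modulo `f`. -/
noncomputable abbrev reduction (P : Type*) [AddCommGroup P] [Module Q P] :
    P →ₗ[Q] (Q ⧸ Ideal.span {f}) ⊗[Q] P := TensorProduct.mk Q (Q ⧸ Ideal.span {f}) P 1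

lemma reduction_surjective (P : Type*) [AddCommGroup P] [Module Q P] :
    Function.Surjective (reduction f P) :=
  TensorProduct.mk_surjective _ _ _ Ideal.Quotient.mk_surjective

lemma reduction_eq_zero {P : Type*} [AddCommGroup P] [Module Q P] (x : P) :
    reduction f P x = 0 ↔ ∃ y, f • y = x := by
  have h : TensorProduct.quotTensorEquivQuotSMul P (Ideal.span {f}) (reduction f P x) =
      Submodule.Quotient.mk x := by
    simp
  rw [← LinearEquiv.map_eq_zero_iff (TensorProduct.quotTensorEquivQuotSMul P (Ideal.span {f})),
    h, Submodule.Quotient.mk_eq_zero, Submodule.ideal_span_singleton_smul,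
    Submodule.mem_smul_pointwise_iff_exists]
  simp

lemma baseChange_reduction {P P' : Type*} [AddCommGroup P] [Module Q P] [AddCommGroup P']
    [Module Q P'] (l : P →ₗ[Q] P') (x : P) :
    l.baseChange (Q ⧸ Ideal.span {f}) (reduction f P x) = reduction f P' (l x) := by
  simp

end Reduction

namespace HomotopyOperators

variable {Q : Type*} [CommRing Q] {f g : Q} {F : ℤ → Type*}
  [∀ i, AddCommGroup (F i)] [∀ i, Module Q (F i)] (H : HomotopyOperators f g F)

/-- The differential modulo `f`. -/
noncomputable def dR (i : ℤ) : (Q ⧸ Ideal.span {f}) ⊗[Q] F (i + 1) →ₗ[Q ⧸ Ideal.span {f}]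
    (Q ⧸ Ideal.span {f}) ⊗[Q] F i := (H.d i).baseChange _

/-- The periodicity operator modulo `f`. -/
noncomputable def yR (i : ℤ) : (Q ⧸ Ideal.span {f}) ⊗[Q] F i →ₗ[Q ⧸ Ideal.span {f}]
    (Q ⧸ Ideal.span {f}) ⊗[Q] F (i + 1 + 1) := (H.y i).baseChange _

/-- The operator `X` modulo `f`. -/
noncomputable def XR (i : ℤ) : (Q ⧸ Ideal.span {f}) ⊗[Q] F i →ₗ[Q ⧸ Ideal.span {f}]
    (Q ⧸ Ideal.span {f}) ⊗[Q] F (i + 1) := (H.X i).baseChange _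

lemma dR_reduction (i : ℤ) (x : F (i + 1)) :
    H.dR i (reduction f _ x) = reduction f _ (H.d i x) := baseChange_reduction _ _ _

lemma yR_reduction (i : ℤ) (x : F i) :
    H.yR i (reduction f _ x) = reduction f _ (H.y i x) := baseChange_reduction _ _ _

lemma XR_reduction (i : ℤ) (x : F i) :
    H.XR i (reduction f _ x) = reduction f _ (H.X i x) := baseChange_reduction _ _ _

lemma reduction_f_smul {i : ℤ} (x : F i) : reduction f _ (f • x) = 0 :=
  (reduction_eq_zero f _).2 ⟨x, rfl⟩

lemma dR_dR (i : ℤ) (x) : H.dR i (H.dR (i + 1) x) = 0 := by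
  obtain ⟨x, rfl⟩ := reduction_surjective f _ x
  rw [dR_reduction, dR_reduction, H.d_d, map_zero]

lemma dR_yR (i : ℤ) (x) : H.dR (i + 1 + 1) (H.yR (i + 1) x) = H.yR i (H.dR i x) := by
  obtain ⟨x, rfl⟩ := reduction_surjective f _ x
  rw [dR_reduction, yR_reduction, dR_reduction, yR_reduction, H.d_y, map_add, reduction_f_smul,
    add_zero]

lemma dR_XR_zero (x) : H.dR 0 (H.XR 0 x) = 0 := by
  obtain ⟨x, rfl⟩ := reduction_surjective f _ x
  rw [XR_reduction, dR_reduction, H.d_X_zero, reduction_f_smul]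

lemma dR_XR (i : ℤ) (x) : H.dR (i + 1) (H.XR (i + 1) x) = -H.XR i (H.dR i x) := by
  obtain ⟨x, rfl⟩ := reduction_surjective f _ x
  rw [XR_reduction, dR_reduction, dR_reduction, XR_reduction, ← map_neg,
    ← sub_eq_zero, ← map_sub, sub_neg_eq_add, H.d_X, reduction_f_smul]

lemma dR_reduction_eq_zero {i : ℤ} {x : F (i + 1)} :
    H.dR i (reduction f _ x) = 0 ↔ ∃ e, H.d i x = f • e := by
  rw [dR_reduction, reduction_eq_zero]
  exact exists_congr fun _ => eq_comm

/-- With `dR_reduction_eq_zero`, the dictionary turning statements about `F` modulo `f` into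
statements about the homology of `R ⊗ F`. -/
lemma mem_bd_iff {i : ℤ} {x : F i} : x ∈ H.bd i ↔ ∃ w, H.dR i w = reduction f _ x := by
  rw [mem_bd]
  constructor
  · rintro ⟨p, q, rfl⟩
    exact ⟨reduction f _ p, by rw [dR_reduction, map_add, reduction_f_smul, add_zero]⟩
  · rintro ⟨w, hw⟩
    obtain ⟨p, rfl⟩ := reduction_surjective f _ w
    rw [dR_reduction, ← sub_eq_zero, ← map_sub, reduction_eq_zero] at hw
    obtain ⟨q, hq⟩ := hw
    exact ⟨p, -q, by rw [smul_neg, hq]; abel⟩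

lemma exists_of_yR_eq (hQ : ∀ j : ℕ, 0 < j → ∃ v : Q, v * j = 1) {i : ℤ}
    {x : (Q ⧸ Ideal.span {f}) ⊗[Q] F (i + 1 + 1)} (hx : H.dR (i + 1) x = 0)
    (hy : ∃ w, H.dR (i + 1 + 1 + 1 + 1) w = H.yR (i + 1 + 1) x) :
    ∃ x', H.dR (i + 1 + 1) x' = x := by
  obtain ⟨x, rfl⟩ := reduction_surjective f _ x
  obtain ⟨e, he⟩ := H.dR_reduction_eq_zero.1 hx
  rw [yR_reduction, ← mem_bd_iff] at hy
  exact H.mem_bd_iff.1 (H.mem_bd_of_y_mem_bd hQ he hy)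

lemma exists_eq_dR_add_yR (hQ : ∀ j : ℕ, 0 < j → ∃ v : Q, v * j = 1) {i : ℤ}
    (hi : 0 ≤ i + 1 + 1) {c : (Q ⧸ Ideal.span {f}) ⊗[Q] F (i + 1 + 1 + 1 + 1)}
    (hc : H.dR (i + 1 + 1 + 1) c = 0) :
    ∃ w a, H.dR (i + 1) a = 0 ∧ H.dR (i + 1 + 1 + 1 + 1) w + H.yR (i + 1 + 1) a = c := by
  obtain ⟨c, rfl⟩ := reduction_surjective f _ c
  obtain ⟨b, hb⟩ := H.dR_reduction_eq_zero.1 hc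
  obtain ⟨a, e, hae, ha⟩ := H.exists_sub_y_mem_bd hQ hi hb
  obtain ⟨w, hw⟩ := H.mem_bd_iff.1 ha
  exact ⟨w, reduction f _ a, H.dR_reduction_eq_zero.2 ⟨e, hae⟩,
    by rw [hw, yR_reduction, map_sub, sub_add_cancel]⟩

lemma exists_eq_dR_add_XR {c : (Q ⧸ Ideal.span {f}) ⊗[Q] F (0 + 1)} (hc : H.dR 0 c = 0) :
    ∃ w b, H.dR (0 + 1) w + H.XR 0 b = c := by
  obtain ⟨c, rfl⟩ := reduction_surjective f _ c
  obtain ⟨b, hb⟩ := H.dR_reduction_eq_zero.1 hc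
  obtain ⟨w, hw⟩ := H.mem_bd_iff.1 (H.exists_sub_X_mem_bd hb)
  exact ⟨w, reduction f _ b, by rw [hw, XR_reduction, map_sub, sub_add_cancel]⟩

lemma exists_of_XR_eq {b : (Q ⧸ Ideal.span {f}) ⊗[Q] F 0}
    (h : ∃ w, H.dR (0 + 1) w = H.XR 0 b) : ∃ x, H.dR 0 x = b := by
  obtain ⟨b, rfl⟩ := reduction_surjective f _ b
  rw [XR_reduction, ← mem_bd_iff] at h
  obtain ⟨x, hx⟩ := H.exists_of_X_mem_bd h
  exact ⟨reduction f _ x, by rw [dR_reduction, hx]⟩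

end HomotopyOperators

/-! ### From a periodic complex to a flat resolution over `R` -/

/-- A complex `C` starting in degree `b` with an endomorphism `y` of degree two that is injective
on homology and surjective in degrees at least `b + 2`, and with `H_b ≅ N ≅ H_{b+1}`, the second
isomorphism being induced by an operator `X`. -/
structure PeriodicComplex (R : Type*) [CommRing R] (N : Type*) [AddCommGroup N] [Module R N]
    (C : ℤ → Type*) [∀ i, AddCommGroup (C i)] [∀ i, Module R (C i)] (b : ℤ) where
  d : ∀ i, C (i + 1) →ₗ[R] C i
  d_d : ∀ i x, d i (d (i + 1) x) = 0
  neg : ∀ i < b, Subsingleton (C i)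
  ε : C b →ₗ[R] N
  ε_surjective : Function.Surjective ε
  ε_exact : Function.Exact (d b) ε
  y : ∀ i, C i →ₗ[R] C (i + 1 + 1)
  d_y : ∀ i x, d (i + 1 + 1) (y (i + 1) x) = y i (d i x)
  y_inj : ∀ i x, d (i + 1) x = 0 → (∃ w, d (i + 1 + 1 + 1 + 1) w = y (i + 1 + 1) x) →
    ∃ x', d (i + 1 + 1) x' = x
  y_surj : ∀ i, b ≤ i + 1 + 1 → ∀ c, d (i + 1 + 1 + 1) c = 0 →
    ∃ w a, d (i + 1) a = 0 ∧ d (i + 1 + 1 + 1 + 1) w + y (i + 1 + 1) a = c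
  X : ∀ i, C i →ₗ[R] C (i + 1)
  d_X_zero : ∀ x, d b (X b x) = 0
  d_X : ∀ i x, d (i + 1) (X (i + 1) x) = -X i (d i x)
  X_surj : ∀ c, d b c = 0 → ∃ w x, d (b + 1) w + X b x = c
  X_inj : ∀ x, (∃ w, d (b + 1) w = X b x) → ∃ x', d b x' = x

/-- The reduction modulo `f` of a projective resolution over `Q` is a periodic complex. -/
theorem exists_periodicComplex {Q : Type*} [CommRing Q] {f g : Q} {F : ℤ → Type*}
    [∀ i, AddCommGroup (F i)] [∀ i, Module Q (F i)] (H : HomotopyOperators f g F)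
    (hQ : ∀ j : ℕ, 0 < j → ∃ v : Q, v * j = 1)
    (N : Type*) [AddCommGroup N] [Module Q N] [Module (Q ⧸ Ideal.span {f}) N]
    [IsScalarTower Q (Q ⧸ Ideal.span {f}) N] (ε : F 0 →ₗ[Q] N) (hε : Function.Surjective ε)
    (h0 : Function.Exact (H.d 0) ε) (b : ℤ) (hb : b = 0) :
    ∃ P : PeriodicComplex (Q ⧸ Ideal.span {f}) N (fun i => (Q ⧸ Ideal.span {f}) ⊗[Q] F i) b,
      ∀ i, P.d i = (H.d i).baseChange _ := by
  subst hb
  have hlift : ∀ x, ε.liftBaseChange (Q ⧸ Ideal.span {f}) (reduction f _ x) = ε x := by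
    intro x; simp
  refine ⟨{
    d := H.dR
    d_d := H.dR_dR
    neg := fun i hi => ?_
    ε := ε.liftBaseChange _
    ε_surjective := fun n => ?_
    ε_exact := fun x => ?_
    y := H.yR
    d_y := H.dR_yR
    y_inj := fun i x => H.exists_of_yR_eq hQ
    y_surj := fun i hi c => H.exists_eq_dR_add_yR hQ hi
    X := H.XR
    d_X_zero := H.dR_XR_zero
    d_X := H.dR_XR
    X_surj := fun c => H.exists_eq_dR_add_XR
    X_inj := fun b => H.exists_of_XR_eq }, fun i => rfl⟩
  · have := H.neg i hi
    exact (reduction_surjective f (F i)).subsingleton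
  · obtain ⟨x, rfl⟩ := hε n
    exact ⟨_, hlift x⟩
  · obtain ⟨x, rfl⟩ := reduction_surjective f _ x
    rw [hlift]
    constructor
    · intro hx
      obtain ⟨p, rfl⟩ := (h0 x).1 hx
      exact ⟨reduction f _ p, H.dR_reduction _ _⟩
    · rintro ⟨w, hw⟩
      obtain ⟨p, rfl⟩ := reduction_surjective f _ w
      rw [← hlift, ← hw, H.dR_reduction, hlift]
      exact h0.apply_apply_eq_zero p

namespace PeriodicComplex

variable {R : Type*} [CommRing R] {N : Type*} [AddCommGroup N] [Module R N]
  {C : ℤ → Type*} [∀ i, AddCommGroup (C i)] [∀ i, Module R (C i)] {t : ℤ}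
  (P : PeriodicComplex R N C (t + 1 + 1 + 1))

/-- The differential of the cone of the periodicity operator. -/
def coneY (i : ℤ) :
    (C (i + 1 + 1 + 1 + 1) × C (i + 1)) →ₗ[R] (C (i + 1 + 1 + 1) × C i) :=
  coneD (C := fun i => C (i + 1 + 1 + 1)) (fun i => P.d (i + 1 + 1 + 1)) P.d
    (fun i => P.y (i + 1)) i

lemma coneY_apply (i : ℤ) (x : C (i + 1 + 1 + 1 + 1) × C (i + 1)) :
    P.coneY i x = (P.d (i + 1 + 1 + 1) x.1 + P.y (i + 1) x.2, -P.d i x.2) := rfl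

/-- Because `y` is injective on homology and misses only the two lowest homology modules of `C`, the
cone has homology only in degrees `t` and `t + 1`. -/
lemma coneY_exact (i : ℤ) (hi : t < i) (x) (hx : P.coneY i x = 0) :
    ∃ x', P.coneY (i + 1) x' = x := by
  obtain ⟨k, rfl⟩ : ∃ k, i = k + 1 := ⟨i - 1, by ring⟩
  exact coneD_exact (C := fun i => C (i + 1 + 1 + 1)) _ _ _ (fun i => P.d_y (i + 1)) (k + 1)
    (fun x hx h => P.y_inj k x hx h)
    (fun c hc => by
      obtain ⟨w, a, ha, h⟩ := P.y_surj (k + 1) (by omega) c hc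
      exact ⟨w, a, ha, h⟩) x hx

variable (G : ℤ → Type*) [∀ i, AddCommGroup (G i)] [∀ i, Module R (G i)]
  (dG : ∀ i, G (i + 1) →ₗ[R] G i)

/-- The differential of the cone of a chain map into the cone of the periodicity operator. -/
def coneZ (z : ∀ i, G (i + 1 + 1) →ₗ[R] C (i + 1 + 1 + 1) × C i) (i : ℤ) :
    ((C (i + 1 + 1 + 1 + 1) × C (i + 1)) × G (i + 1 + 1)) →ₗ[R]
      (C (i + 1 + 1 + 1) × C i) × G (i + 1) :=
  coneD (C := fun i => C (i + 1 + 1 + 1) × C i) (D := fun i => G (i + 1)) P.coneY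
    (fun i => dG (i + 1)) z i

lemma coneZ_apply (z : ∀ i, G (i + 1 + 1) →ₗ[R] C (i + 1 + 1 + 1) × C i) (i : ℤ) (x) :
    P.coneZ G dG z i x = (P.coneY i x.1 + z i x.2, -dG (i + 1) x.2) := rfl

variable [∀ i, Module.Projective R (G i)] (εG : G (t + 1 + 1 + 1) →ₗ[R] N)

/-- A projective resolution `G` of `N` maps to the cone of the periodicity operator such that the
cone of this map is a resolution of `N` that starts three degrees lower. -/
theorem exists_resolution (hG : ∀ i < t + 1 + 1 + 1, Subsingleton (G i))
    (hdG : ∀ i x, dG i (dG (i + 1) x) = 0)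
    (exG : ∀ i, t + 1 + 1 + 1 ≤ i → Function.Exact (dG (i + 1)) (dG i))
    (hεG : Function.Surjective εG) (exεG : Function.Exact (dG (t + 1 + 1 + 1)) εG) :
    ∃ z : ∀ i, G (i + 1 + 1) →ₗ[R] C (i + 1 + 1 + 1) × C i,
      (∀ i x, P.coneY i (z (i + 1) x) = z i (dG (i + 1 + 1) x)) ∧
      (∀ i, t ≤ i → Function.Exact (P.coneZ G dG z (i + 1)) (P.coneZ G dG z i)) ∧
      ∃ ε : ((C (t + 1 + 1 + 1) × C t) × G (t + 1)) →ₗ[R] N,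
        Function.Surjective ε ∧ Function.Exact (P.coneZ G dG z t) ε := by
  obtain ⟨l, hl⟩ := Module.exists_lift_of_forall_exists P.ε εG (fun x => P.ε_surjective _)
  have := P.neg t (by omega)
  have := P.neg (t + 1) (by omega)
  have := P.neg (t + 1 + 1) (by omega)
  have := hG (t + 1) (by omega)
  have := hG (t + 1 + 1) (by omega)
  -- `X` identifies the bottom homology of `C` with the next one, which is the unwanted homology of
  -- the cone in degree `t + 1`; `φ` is built to hit exactly that.
  let φ : G (t + 1 + 1 + 1) →ₗ[R] C (t + 1 + 1 + 1 + 1) × C (t + 1) :=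
    LinearMap.inl R _ _ ∘ₗ P.X _ ∘ₗ l
  have hφ : ∀ x, φ x = (P.X _ (l x), 0) := fun x => rfl
  -- The obstruction to extending `φ`: `l` of a boundary is a boundary `d v`, and `X` anticommutes
  -- with `d`, so `-X v` provides the bounding element.
  have hφd : ∀ x, ∃ y, P.coneY (t + 1) y = φ (dG _ x) := by
    intro x
    obtain ⟨v, hv⟩ := (P.ε_exact (l (dG _ x))).1 (by rw [hl, exεG.apply_apply_eq_zero])
    refine ⟨(-P.X _ v, 0), ?_⟩
    rw [coneY_apply, hφ]
    refine Prod.ext ?_ ?_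
    · simp only [map_zero, add_zero, map_neg]
      rw [P.d_X, hv, neg_neg]
    · simp
  -- A null homotopy of the zero map for the negated differential is a chain map; it is prescribed
  -- to be `φ` in degree `t`.
  obtain ⟨h, hneg, hh⟩ := exists_homotopy_extension t (fun i => G (i + 1 + 1 + 1))
    (fun i => C (i + 1 + 1 + 1) × C i) (fun i => dG (i + 1 + 1 + 1)) (fun i => -P.coneY i) 0
    (fun i => hdG (i + 1 + 1 + 1))
    (fun i hi x hx => by
      obtain ⟨y, hy⟩ := P.coneY_exact i hi x (by simpa using hx)
      exact ⟨-y, by simpa using hy⟩)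
    (fun i _ x => by simp) (Function.update 0 t φ)
    (fun x => by
      obtain ⟨y, hy⟩ := hφd x
      refine ⟨y, ?_⟩
      rw [Function.update_self, Pi.zero_apply, LinearMap.zero_apply, zero_sub]
      exact congrArg (-·) hy)
  obtain ⟨z, hz⟩ := exists_family_of_succ (β := fun i => G (i + 1 + 1) →ₗ[R]
    C (i + 1 + 1 + 1) × C i) h
  have hzφ : z (t + 1) = φ := by rw [hz, hneg t le_rfl, Function.update_self]
  have hzchain : ∀ i x, P.coneY i (z (i + 1) x) = z i (dG (i + 1 + 1) x) := by
    intro i x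
    rcases lt_or_ge i (t + 1) with hi | hi
    · rcases (Int.lt_add_one_iff.1 hi).eq_or_lt with rfl | hi
      · rw [hzφ, hφ, coneY_apply, Subsingleton.elim (dG (i + 1 + 1) x) 0, map_zero]
        simp [P.d_X_zero]
      · have := hG (i + 1 + 1 + 1) (by omega)
        rw [Subsingleton.elim x 0]; simp
    · obtain ⟨k, rfl⟩ : ∃ k, i = k + 1 := ⟨i - 1, by ring⟩
      rw [hz, hz]
      have := hh k (by omega) x
      rwa [Pi.zero_apply, LinearMap.zero_apply, LinearMap.neg_apply, neg_add_eq_zero] at this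
  refine ⟨z, hzchain, fun i hi k => ⟨fun hk => ?_, ?_⟩, ?_⟩
  · refine coneD_exact (C := fun i => C (i + 1 + 1 + 1) × C i) (D := fun i => G (i + 1))
      P.coneY (fun i => dG (i + 1)) z hzchain i ?_ ?_ k hk
    -- Injectivity of `z` on homology: the source vanishes at `i = t`, `X_inj` settles `i = t + 1`,
    -- and `G` is exact beyond.
    · intro x hx hc
      rcases hi.eq_or_lt with rfl | hi
      · exact ⟨0, Subsingleton.elim _ _⟩
      rcases (Int.add_one_le_iff.2 hi).eq_or_lt with rfl | hi
      · obtain ⟨⟨c, c'⟩, hc⟩ := hc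
        have := congrArg Prod.fst hc
        rw [hzφ, coneY_apply, hφ, Subsingleton.elim c' 0] at this
        simp only [map_zero, add_zero] at this
        obtain ⟨v, hv⟩ := P.X_inj _ ⟨_, this⟩
        exact (exεG x).1 (by rw [← hl, ← hv, P.ε_exact.apply_apply_eq_zero])
      · exact (exG (i + 1) (by omega) x).1 hx
    · intro c hc
      rcases hi.eq_or_lt with rfl | hi
      · obtain ⟨c, c'⟩ := c
        have h1 := congrArg Prod.fst hc
        rw [coneY_apply, Subsingleton.elim c' 0] at h1
        simp only [map_zero, add_zero] at h1
        -- The class of `c` is `X b`, and `b` may be changed to `l x` with the same image in `N`,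
        -- since the two differ by a boundary.
        obtain ⟨w, b, hb⟩ := P.X_surj c h1
        obtain ⟨x, hx⟩ := hεG (P.ε b)
        obtain ⟨v, hv⟩ := (P.ε_exact (l x - b)).1 (by rw [map_sub, hl, hx, sub_self])
        refine ⟨(w + P.X _ v, 0), x, Subsingleton.elim _ _, ?_⟩
        rw [hzφ, hφ, coneY_apply]
        refine Prod.ext ?_ (Subsingleton.elim _ _)
        simp only [map_zero, add_zero, map_add, Prod.fst_add]
        rw [P.d_X, hv, map_sub, ← hb]
        abel
      · obtain ⟨c', hc'⟩ := P.coneY_exact i hi c hc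
        exact ⟨c', 0, by simp, by simp [hc']⟩
  · rintro ⟨k', rfl⟩
    exact coneD_coneD (C := fun i => C (i + 1 + 1 + 1) × C i) (D := fun i => G (i + 1)) _ _ _
      (fun i x => coneD_coneD (C := fun i => C (i + 1 + 1 + 1)) _ _ _
      (fun i => P.d_d (i + 1 + 1 + 1)) P.d_d (fun i => P.d_y (i + 1)) i x)
      (fun i => hdG (i + 1)) hzchain i k'
  · refine ⟨P.ε ∘ₗ LinearMap.fst R _ _ ∘ₗ LinearMap.fst R _ _, fun n => ?_, fun k => ⟨?_, ?_⟩⟩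
    · obtain ⟨c, rfl⟩ := P.ε_surjective n
      exact ⟨((c, 0), 0), rfl⟩
    · intro hk
      obtain ⟨c, hc⟩ := (P.ε_exact k.1.1).1 hk
      refine ⟨((c, 0), 0), Prod.ext (Prod.ext ?_ (Subsingleton.elim _ _))
        (Subsingleton.elim _ _)⟩
      rw [coneZ_apply, coneY_apply]
      simpa using hc
    · rintro ⟨⟨⟨c, c'⟩, x⟩, rfl⟩
      rw [coneZ_apply, coneY_apply, Subsingleton.elim c' 0, Subsingleton.elim x 0]
      simpa using P.ε_exact.apply_apply_eq_zero c

end PeriodicComplex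

/-! ### Tensoring with `M` and change of rings -/

/-- The long exact sequence of a tensored cone. -/
theorem exists_cone_tensor_sequence {A : Type*} [CommRing A] {C D : ℤ → Type*}
    [∀ i, AddCommGroup (C i)] [∀ i, Module A (C i)]
    [∀ i, AddCommGroup (D i)] [∀ i, Module A (D i)]
    (dC : ∀ i, C (i + 1) →ₗ[A] C i) (dD : ∀ i, D (i + 1) →ₗ[A] D i)
    (z : ∀ i, D (i + 1) →ₗ[A] C i) (hz : ∀ i x, dC i (z (i + 1) x) = z i (dD (i + 1) x))
    (M : Type*) [AddCommGroup M] [Module A M] :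
    ∃ (a : ∀ k, MiddleHomology ((dD (k + 1 + 1)).lTensor M) ((dD (k + 1)).lTensor M) →ₗ[A]
        MiddleHomology ((dC (k + 1)).lTensor M) ((dC k).lTensor M))
      (b : ∀ k, MiddleHomology ((dC (k + 1)).lTensor M) ((dC k).lTensor M) →ₗ[A]
        MiddleHomology ((coneD dC dD z (k + 1)).lTensor M) ((coneD dC dD z k).lTensor M))
      (c : ∀ k, MiddleHomology ((coneD dC dD z (k + 1)).lTensor M)
          ((coneD dC dD z k).lTensor M) →ₗ[A]
        MiddleHomology ((dD (k + 1)).lTensor M) ((dD k).lTensor M)),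
      ∀ k, Function.Exact (a k) (b k) ∧ Function.Exact (b k) (c k) ∧
        Function.Exact (c (k + 1)) (a k) := by
  have hz' : ∀ i x, (dC i).lTensor M ((z (i + 1)).lTensor M x) =
      (z i).lTensor M ((dD (i + 1)).lTensor M x) := fun i x => by
    rw [← LinearMap.lTensor_comp_apply, ← LinearMap.lTensor_comp_apply]
    congr 2
    exact LinearMap.ext (hz i)
  let C' : ℤ → Type _ := fun i => M ⊗[A] C i
  let D' : ℤ → Type _ := fun i => M ⊗[A] D i
  let dC' : ∀ i, C' (i + 1) →ₗ[A] C' i := fun i => (dC i).lTensor M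
  let dD' : ∀ i, D' (i + 1) →ₗ[A] D' i := fun i => (dD i).lTensor M
  let z' : ∀ i, D' (i + 1) →ₗ[A] C' i := fun i => (z i).lTensor M
  let e (k : ℤ) := MiddleHomology.coneTensorEquiv dC dD z M k
  refine ⟨MiddleHomology.coneδ dC' dD' z' hz',
    fun k => (e k).symm.toLinearMap ∘ₗ MiddleHomology.coneInl dC' dD' z' k,
    fun k => MiddleHomology.coneSnd dC' dD' z' k ∘ₗ (e k).toLinearMap,
    fun k => ⟨fun x => ?_, fun x => ?_, fun x => ?_⟩⟩
  · exact (e k).symm.map_eq_zero_iff.trans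
      (MiddleHomology.exact_coneδ_coneInl dC' dD' z' hz' k x)
  · refine (MiddleHomology.exact_coneInl_coneSnd dC' dD' z' hz' k (e k x)).trans
      (exists_congr fun y => ?_)
    exact (LinearEquiv.symm_apply_eq _).symm
  · refine (MiddleHomology.exact_coneSnd_coneδ dC' dD' z' hz' k x).trans
      ((e (k + 1)).surjective.exists.trans ?_)
    rfl

section ChangeOfRings

variable {Q R : Type*} [CommRing Q] [CommRing R] [Algebra Q R]

/-- Homology of a complex of `R`-modules, seen as a complex of modules over `Q`. -/
noncomputable def MiddleHomology.congrRestrictScalars {X Y Z X' Y' Z' : Type*}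
    [AddCommGroup X] [Module Q X] [AddCommGroup Y] [Module Q Y] [AddCommGroup Z] [Module Q Z]
    [AddCommGroup X'] [Module R X'] [AddCommGroup Y'] [Module R Y'] [Module Q Y']
    [IsScalarTower Q R Y'] [AddCommGroup Z'] [Module R Z']
    (f : X →ₗ[Q] Y) (g : Y →ₗ[Q] Z) (f' : X' →ₗ[R] Y') (g' : Y' →ₗ[R] Z')
    (e : Y ≃ₗ[Q] Y') (hg : ∀ y, g y = 0 ↔ g' (e y) = 0)
    (hf : ∀ y, (∃ x, f x = y) ↔ ∃ x', f' x' = e y) :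
    MiddleHomology f g ≃ₗ[Q] MiddleHomology f' g' :=
  let c : LinearMap.ker g →ₗ[Q] LinearMap.ker g' :=
    { toFun := fun y => ⟨e y.1, (hg _).1 y.2⟩
      map_add' := fun x y => Subtype.ext (map_add e _ _)
      map_smul' := fun q x => Subtype.ext (map_smul e _ _) }
  LinearEquiv.ofSurjectiveOfKerEq (π f g) ((π f' g').restrictScalars Q ∘ₗ c)
    (Submodule.mkQ_surjective _)
    (fun x => by
      obtain ⟨y, hy, rfl⟩ := mk_surjective _ _ x
      refine ⟨⟨e.symm y, (hg _).2 (by simpa using hy)⟩, ?_⟩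
      change mk f' g' (e (e.symm y)) _ = _
      congr 1
      simp)
    (fun ⟨y, hy⟩ => (mk_eq_zero f g y hy).trans
      ((hf y).trans (mk_eq_zero f' g' (e y) ((hg y).1 hy)).symm))

/-- Homology of `M ⊗ F` and of `M ⊗ (R ⊗ F)` agree. -/
theorem nonempty_middleHomology_baseChange_equiv {X Y Z : Type*}
    [AddCommGroup X] [Module Q X] [AddCommGroup Y] [Module Q Y] [AddCommGroup Z] [Module Q Z]
    (M : Type*) [AddCommGroup M] [Module Q M] [Module R M] [IsScalarTower Q R M]
    (f : X →ₗ[Q] Y) (g : Y →ₗ[Q] Z) :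
    Nonempty (MiddleHomology (f.lTensor M) (g.lTensor M) ≃ₗ[Q]
      MiddleHomology ((f.baseChange R).lTensor M) ((g.baseChange R).lTensor M)) := by
  let e₁ := (AlgebraTensorModule.cancelBaseChange Q R R M X).symm.restrictScalars Q
  let e₂ := (AlgebraTensorModule.cancelBaseChange Q R R M Y).symm.restrictScalars Q
  let e₃ := (AlgebraTensorModule.cancelBaseChange Q R R M Z).symm.restrictScalars Q
  have hf : ∀ x, (f.baseChange R).lTensor M (e₁ x) = e₂ (f.lTensor M x) := by
    intro x
    induction x with
    | zero => simp
    | add x y hx hy => simp only [map_add, hx, hy]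
    | tmul m x => simp [e₁, e₂]
  have hg : ∀ x, (g.baseChange R).lTensor M (e₂ x) = e₃ (g.lTensor M x) := by
    intro x
    induction x with
    | zero => simp
    | add x y hx hy => simp only [map_add, hx, hy]
    | tmul m x => simp [e₂, e₃]
  refine ⟨MiddleHomology.congrRestrictScalars _ _ _ _ e₂ (fun y => ?_) (fun y => ⟨?_, ?_⟩)⟩
  · rw [hg, LinearEquiv.map_eq_zero_iff]
  · rintro ⟨x, rfl⟩
    exact ⟨e₁ x, hf x⟩
  · rintro ⟨x, hx⟩
    obtain ⟨x, rfl⟩ := e₁.surjective x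
    exact ⟨x, e₂.injective (by rw [← hf, hx])⟩

end ChangeOfRings

/-- An `R`-linear equivalence, seen as a `Q`-linear one. -/
noncomputable def asModuleOverEquiv {Q : Type u} [CommRing Q] (f : Q)
    {T : ModuleCat.{u} (Q ⧸ Ideal.span {f})} {H : Type*} [AddCommGroup H]
    [Module (Q ⧸ Ideal.span {f}) H] [Module Q H] [IsScalarTower Q (Q ⧸ Ideal.span {f}) H]
    (e : T ≃ₗ[Q ⧸ Ideal.span {f}] H) : asModuleOver f T ≃ₗ[Q] H :=
  { e.toAddEquiv with
    map_smul' := fun q x => (e.map_smul (Ideal.Quotient.mk _ q) x).trans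
      (algebraMap_smul (Q ⧸ Ideal.span {f}) q (e x)) }

/-- Residue characteristic zero enters here: a positive integer is nonzero in the residue field,
hence a unit of the local ring. -/
lemma exists_mul_natCast_eq_one {Q : Type*} [CommRing Q] [IsLocalRing Q]
    [CharZero (IsLocalRing.ResidueField Q)] (j : ℕ) (hj : 0 < j) : ∃ v : Q, v * j = 1 := by
  have h : IsUnit (j : Q) := by
    rw [← IsLocalRing.residue_ne_zero_iff_isUnit, map_natCast]
    exact Nat.cast_ne_zero.2 hj.ne'
  obtain ⟨u, hu⟩ := h
  exact ⟨↑u⁻¹, by rw [← hu, Units.inv_mul]⟩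

set_option maxHeartbeats 1000000 in
/-- For an exact pair of zero divisors `f`, `g` and a module `N` over `R = Q/(f)` killed by `g`,
there are modules `h` in two long exact sequences, one with the `Tor` modules over `Q` and one with
the `Tor` modules over `R`. -/
theorem exists_tor_sequences {Q : Type u} [CommRing Q] (f g : Q)
    (hfg : IsExactPairOfZeroDivisors f g) (hQ : ∀ j : ℕ, 0 < j → ∃ v : Q, v * j = 1)
    (M N : Type u)
    [AddCommGroup M] [Module Q M] [Module (Q ⧸ Ideal.span {f}) M]
    [IsScalarTower Q (Q ⧸ Ideal.span {f}) M]
    [AddCommGroup N] [Module Q N] [Module (Q ⧸ Ideal.span {f}) N]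
    [IsScalarTower Q (Q ⧸ Ideal.span {f}) N] (hgN : ∀ x : N, g • x = 0) :
    ∃ (T h S K : ℤ → ModuleCat.{u} (Q ⧸ Ideal.span {f}))
      (a : ∀ k, T (k + 1) →ₗ[Q ⧸ Ideal.span {f}] T (k + 1 + 1 + 1))
      (b : ∀ k, T (k + 1 + 1 + 1) →ₗ[Q ⧸ Ideal.span {f}] h k)
      (c : ∀ k, h k →ₗ[Q ⧸ Ideal.span {f}] T k)
      (p : ∀ k, S (k + 1 + 1) →ₗ[Q ⧸ Ideal.span {f}] h k)
      (q : ∀ k, h k →ₗ[Q ⧸ Ideal.span {f}] K k)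
      (r : ∀ k, K k →ₗ[Q ⧸ Ideal.span {f}] S (k + 1)),
      (∀ k, Function.Exact (a k) (b k) ∧ Function.Exact (b k) (c k) ∧
        Function.Exact (c (k + 1)) (a k)) ∧
      (∀ k, Function.Exact (p k) (q k) ∧ Function.Exact (q k) (r k) ∧
        Function.Exact (r (k + 1)) (p k)) ∧
      (∀ k, Nonempty (torModule Q M N (k + 1) ≃ₗ[Q] asModuleOver f (T k))) ∧
      (∀ k, Nonempty (torModule (Q ⧸ Ideal.span {f}) M N (k + 1) ≃ₗ[Q ⧸ Ideal.span {f}] S k)) ∧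
      (∀ k, Nonempty (torModule (Q ⧸ Ideal.span {f}) M N (k + 4) ≃ₗ[Q ⧸ Ideal.span {f}] K k)) := by
  -- Taking `t = -3` lets `C` and `G` start in degree zero, so that the second cone is a resolution
  -- starting in degree `-3`.
  have hb : (-3 + 1 + 1 + 1 : ℤ) = 0 := by norm_num
  have hfN : ∀ x : N, f • x = 0 := fun x => by
    rw [← algebraMap_smul (Q ⧸ Ideal.span {f}) f x, Ideal.Quotient.algebraMap_eq,
      Ideal.Quotient.eq_zero_iff_mem.2 (Ideal.mem_span_singleton_self f), zero_smul]
  obtain ⟨F, dF, εF, projF, negF, surjF, ex0F, exF, ddF⟩ :=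
    exists_int_projective_resolution Q N 0 rfl
  obtain ⟨G, dG, εG, projG, negG, surjG, ex0G, exG, ddG⟩ :=
    exists_int_projective_resolution (Q ⧸ Ideal.span {f}) N _ hb
  obtain ⟨H, rfl⟩ := nonempty_homotopyOperators f g (fun i => F i) dF ddF
    (fun i hi x hx => (exF i hi x).1 hx) negF
    (by rw [mul_comm]; exact (hfg.ann_left g).2 (Ideal.mem_span_singleton_self g))
    (fun i x hx => Module.Flat.exists_smul_eq_of_smul_eq_zero hfg.ann_left hx)
    (fun i x hx => Module.Flat.exists_smul_eq_of_smul_eq_zero hfg.ann_right hx)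
    (fun x => (ex0F _).1 (by rw [map_smul, hfN])) (fun x => (ex0F _).1 (by rw [map_smul, hgN]))
  obtain ⟨P, hP⟩ := exists_periodicComplex H hQ N εF surjF ex0F _ hb
  obtain ⟨z, hz, exK, εK, surjK, ex0K⟩ :=
    P.exists_resolution (fun i => G i) dG εG negG ddG exG surjG ex0G
  obtain ⟨a, b, c, habc⟩ := exists_cone_tensor_sequence
    (C := fun i => (Q ⧸ Ideal.span {f}) ⊗[Q] F (i + 1 + 1 + 1))
    (D := fun i => (Q ⧸ Ideal.span {f}) ⊗[Q] F i)
    (fun i => P.d (i + 1 + 1 + 1)) P.d (fun i => P.y (i + 1)) (fun i => P.d_y (i + 1)) M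
  obtain ⟨p, q, r, hpqr⟩ := exists_cone_tensor_sequence
    (C := fun i => (Q ⧸ Ideal.span {f}) ⊗[Q] F (i + 1 + 1 + 1) × (Q ⧸ Ideal.span {f}) ⊗[Q] F i)
    (D := fun i => G (i + 1)) P.coneY (fun i => dG (i + 1)) z hz M
  refine ⟨fun k => ModuleCat.of _ (MiddleHomology ((P.d (k + 1)).lTensor M) ((P.d k).lTensor M)),
    fun k => ModuleCat.of _ (MiddleHomology ((P.coneY (k + 1)).lTensor M)
      ((P.coneY k).lTensor M)),
    fun k => ModuleCat.of _ (MiddleHomology ((dG (k + 1)).lTensor M) ((dG k).lTensor M)),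
    fun k => ModuleCat.of _ (MiddleHomology ((P.coneZ (fun i => G i) dG z (k + 1)).lTensor M)
      ((P.coneZ (fun i => G i) dG z k).lTensor M)),
    a, b, c, p, q, r, habc, hpqr, fun k => ?_, fun k => ?_, fun k => ?_⟩
  · obtain ⟨e⟩ := nonempty_torModule_equiv_of_shifted_flat_resolution Q M N (-1) 0 (by norm_num)
      (fun i => F i) H.d εF negF surjF ex0F exF k
    obtain ⟨e'⟩ := nonempty_middleHomology_baseChange_equiv (R := Q ⧸ Ideal.span {f}) M
      (H.d (k + 1)) (H.d k)
    rw [sub_neg_eq_add] at e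
    rw [← hP, ← hP] at e'
    let e'' : asModuleOver f (ModuleCat.of _
        (MiddleHomology ((P.d (k + 1)).lTensor M) ((P.d k).lTensor M))) ≃ₗ[Q]
        MiddleHomology ((P.d (k + 1)).lTensor M) ((P.d k).lTensor M) :=
      asModuleOverEquiv f (LinearEquiv.refl _ _)
    exact ⟨e ≪≫ₗ e' ≪≫ₗ e''.symm⟩
  · obtain ⟨e⟩ := nonempty_torModule_equiv_of_shifted_flat_resolution _ M N (-1) _ (by norm_num)
      (fun i => G i) dG εG negG surjG ex0G exG k
    rw [sub_neg_eq_add] at e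
    exact ⟨e⟩
  · obtain ⟨e⟩ := nonempty_torModule_equiv_of_shifted_flat_resolution _ M N (-4) (-3)
      (by norm_num) (fun i => ((Q ⧸ Ideal.span {f}) ⊗[Q] F (i + 1 + 1 + 1) ×
        (Q ⧸ Ideal.span {f}) ⊗[Q] F i) × G (i + 1)) (P.coneZ (fun i => G i) dG z) εK
      (fun i hi => by
        have := P.neg (i + 1 + 1 + 1) (by omega)
        have := P.neg i (by omega)
        have := negG (i + 1) (by omega)
        infer_instance) surjK ex0K exK k
    rw [sub_neg_eq_add] at e
    exact ⟨e⟩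

/-! ### Comparison of Tor over `Q` and over `R`, and the conclusion -/

/-- Restriction of scalars on linear maps. -/
noncomputable def asModuleOverMap {Q : Type u} [CommRing Q] (f : Q) {X Y : ModuleCat.{u} (Q ⧸ Ideal.span {f})}
    (l : X →ₗ[Q ⧸ Ideal.span {f}] Y) : asModuleOver f X →ₗ[Q] asModuleOver f Y :=
  ((ModuleCat.restrictScalars (Ideal.Quotient.mk (Ideal.span {f}))).map (ModuleCat.ofHom l)).hom

/-- Restriction of scalars on linear equivalences. -/
noncomputable def asModuleOverCongr {Q : Type u} [CommRing Q] (f : Q)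
    {X Y : ModuleCat.{u} (Q ⧸ Ideal.span {f})}
    (l : X ≃ₗ[Q ⧸ Ideal.span {f}] Y) : asModuleOver f X ≃ₗ[Q] asModuleOver f Y :=
  ((ModuleCat.restrictScalars (Ideal.Quotient.mk (Ideal.span {f}))).mapIso
    l.toModuleIso).toLinearEquiv

/-- For an exact pair of zero divisors `f`, `g` and a module `N` over `R = Q/(f)` killed by `g`,
there are modules `h` that vanish where consecutive `Tor` modules over `R` do and that measure the
periodicity of the `Tor` modules over `Q`. -/
theorem exists_tor_comparison {Q : Type u} [CommRing Q] (f g : Q)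
    (hfg : IsExactPairOfZeroDivisors f g) (hQ : ∀ j : ℕ, 0 < j → ∃ v : Q, v * j = 1)
    (M N : Type u)
    [AddCommGroup M] [Module Q M] [Module (Q ⧸ Ideal.span {f}) M]
    [IsScalarTower Q (Q ⧸ Ideal.span {f}) M]
    [AddCommGroup N] [Module Q N] [Module (Q ⧸ Ideal.span {f}) N]
    [IsScalarTower Q (Q ⧸ Ideal.span {f}) N] (hgN : ∀ x : N, g • x = 0) :
    ∃ h : ℤ → ModuleCat.{u} Q,
      (∀ j, Subsingleton (h j) → Subsingleton (h (j + 1)) →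
        Nonempty (torModule Q M N (j - 2) ≃ₗ[Q] torModule Q M N j)) ∧
      (∀ j, ∃ (α : torModule Q M N (j - 2) →ₗ[Q] torModule Q M N j)
        (β : torModule Q M N j →ₗ[Q] h j) (γ : h j →ₗ[Q] torModule Q M N (j - 3)),
        Function.Exact α β ∧ Function.Exact β γ) ∧
      (∀ j, Subsingleton (torModule (Q ⧸ Ideal.span {f}) M N (j - 1)) →
        Subsingleton (torModule (Q ⧸ Ideal.span {f}) M N j) → Subsingleton (h j)) ∧
      (∀ j, Subsingleton (torModule (Q ⧸ Ideal.span {f}) M N j) →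
        Subsingleton (torModule (Q ⧸ Ideal.span {f}) M N (j + 1)) →
        Nonempty (asModuleOver f (torModule (Q ⧸ Ideal.span {f}) M N (j - 1)) ≃ₗ[Q] h j)) := by
  obtain ⟨T, h, S, K, a, b, c, p, q, r, habc, hpqr, eT', eS', eK'⟩ :=
    exists_tor_sequences f g hfg hQ M N hgN
  have eT : ∀ j k, j = k + 1 → Nonempty (torModule Q M N j ≃ₗ[Q] asModuleOver f (T k)) := by
    rintro j k rfl; exact eT' k
  have eS : ∀ j k, j = k + 1 → Nonempty (torModule (Q ⧸ Ideal.span {f}) M N j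
      ≃ₗ[Q ⧸ Ideal.span {f}] S k) := by
    rintro j k rfl; exact eS' k
  have eK : ∀ j k, j = k + 4 → Nonempty (torModule (Q ⧸ Ideal.span {f}) M N j
      ≃ₗ[Q ⧸ Ideal.span {f}] K k) := by
    rintro j k rfl; exact eK' k
  -- The shift by four aligns `h j` with Tor_j over both rings: as `Tor^Q_j → h j` and as `h j →
  -- Tor^R_j`.
  refine ⟨fun j => asModuleOver f (h (j - 4)), fun j h₁ h₂ => ?_, fun j => ?_, fun j h₁ h₂ => ?_,
    fun j h₁ h₂ => ?_⟩
  all_goals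
    obtain ⟨k, rfl⟩ : ∃ k, j = k + 4 := ⟨j - 4, by ring⟩
    beta_reduce at *
  · rw [show k + 4 + 1 - 4 = k + 1 by ring] at h₂
    rw [add_sub_cancel_right] at h₁
    change Subsingleton (h _) at h₁ h₂
    obtain ⟨e₁⟩ := eT (k + 4 - 2) (k + 1) (by ring)
    obtain ⟨e₂⟩ := eT (k + 4) (k + 1 + 1 + 1) (by ring)
    obtain ⟨hab, -, hca⟩ := habc k
    have hinj : Function.Injective (a k) := (injective_iff_map_eq_zero _).2 fun x hx => by
      obtain ⟨y, rfl⟩ := (hca x).1 hx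
      rw [Subsingleton.elim y 0, map_zero]
    have hsurj : Function.Surjective (a k) := fun x => (hab x).1 (Subsingleton.elim _ _)
    exact ⟨e₁ ≪≫ₗ asModuleOverCongr f (LinearEquiv.ofBijective (a k) ⟨hinj, hsurj⟩) ≪≫ₗ e₂.symm⟩
  · rw [add_sub_cancel_right]
    obtain ⟨e₁⟩ := eT (k + 4 - 2) (k + 1) (by ring)
    obtain ⟨e₂⟩ := eT (k + 4) (k + 1 + 1 + 1) (by ring)
    obtain ⟨e₃⟩ := eT (k + 4 - 3) k (by ring)
    obtain ⟨hab, hbc, -⟩ := habc k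
    refine ⟨e₂.symm.toLinearMap ∘ₗ asModuleOverMap f (a k) ∘ₗ e₁.toLinearMap,
      asModuleOverMap f (b k) ∘ₗ e₂.toLinearMap,
      e₃.symm.toLinearMap ∘ₗ asModuleOverMap f (c k), fun x => ?_, fun x => ?_⟩
    · refine (hab (e₂ x)).trans (e₁.surjective.exists.trans (exists_congr fun y => ?_))
      exact (LinearEquiv.symm_apply_eq _).symm
    · exact e₃.symm.map_eq_zero_iff.trans ((hbc x).trans e₂.surjective.exists)
  · rw [add_sub_cancel_right]
    obtain ⟨e₁⟩ := eS (k + 4 - 1) (k + 1 + 1) (by ring)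
    obtain ⟨e₂⟩ := eK (k + 4) k rfl
    obtain ⟨hpq, -, -⟩ := hpqr k
    have := e₁.surjective.subsingleton
    have := e₂.surjective.subsingleton
    refine subsingleton_of_forall_eq (0 : h k) fun x => ?_
    obtain ⟨y, rfl⟩ := (hpq x).1 (Subsingleton.elim _ _)
    rw [Subsingleton.elim y 0, map_zero]
  · rw [add_sub_cancel_right]
    obtain ⟨e₁⟩ := eS (k + 4 - 1) (k + 1 + 1) (by ring)
    obtain ⟨e₂⟩ := eK (k + 4) k rfl
    obtain ⟨e₃⟩ := eK (k + 4 + 1) (k + 1) (by ring)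
    obtain ⟨hpq, -, hrp⟩ := hpqr k
    have := e₂.surjective.subsingleton
    have := e₃.surjective.subsingleton
    have hinj : Function.Injective (p k) := (injective_iff_map_eq_zero _).2 fun x hx => by
      obtain ⟨y, rfl⟩ := (hrp x).1 hx
      rw [Subsingleton.elim y 0, map_zero]
    have hsurj : Function.Surjective (p k) := fun x => (hpq x).1 (Subsingleton.elim _ _)
    exact ⟨asModuleOverCongr f (e₁ ≪≫ₗ LinearEquiv.ofBijective (p k) ⟨hinj, hsurj⟩)⟩

theorem mainTheorem7
    {Q : Type u} [CommRing Q] [IsLocalRing Q] [CharZero (IsLocalRing.ResidueField Q)]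
    (f g : Q) (hfg : IsExactPairOfZeroDivisors f g)
    (M N : Type u)
    [AddCommGroup M] [Module Q M] [Module (Q ⧸ Ideal.span {f}) M]
    [IsScalarTower Q (Q ⧸ Ideal.span {f}) M]
    [AddCommGroup N] [Module Q N] [Module (Q ⧸ Ideal.span {f}) N]
    [IsScalarTower Q (Q ⧸ Ideal.span {f}) N]
    (hgN : ∀ x : N, g • x = 0)
    (m n : ℤ) (hm : 0 ≤ m) (hmn : 1 ≤ n - m)
    (hTor : ∀ i : ℤ, m ≤ i → i ≤ n →
      Subsingleton (torModule (Q ⧸ Ideal.span {f}) M N i)) :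
    (∀ i : ℤ, m ≤ i → i ≤ n - 2 →
      Nonempty (torModule Q M N (i - 1) ≃ₗ[Q] torModule Q M N (i + 1))) ∧
    (∃ (α : torModule Q M N (m - 2) →ₗ[Q] torModule Q M N m)
       (β : torModule Q M N m →ₗ[Q]
          asModuleOver f (torModule (Q ⧸ Ideal.span {f}) M N (m - 1)))
       (γ : asModuleOver f (torModule (Q ⧸ Ideal.span {f}) M N (m - 1)) →ₗ[Q]
          torModule Q M N (m - 3)),
      Function.Exact α β ∧ Function.Exact β γ) ∧
    (m = 1 → ∀ i : ℤ, 1 ≤ i → i ≤ n - 1 →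
      Nonempty (TensorProduct Q M N ≃ₗ[Q] torModule Q M N i)) := by
  obtain ⟨h, hA, hB, hC, hD⟩ :=
    exists_tor_comparison f g hfg exists_mul_natCast_eq_one M N hgN
  have hzero : ∀ j, m < j → j ≤ n → Subsingleton (h j) := fun j h₁ h₂ =>
    hC j (hTor _ (by omega) (by omega)) (hTor _ (by omega) (by omega))
  obtain ⟨e⟩ := hD m (hTor _ le_rfl (by omega)) (hTor _ (by omega) (by omega))
  have hper : ∀ i : ℤ, m ≤ i → i ≤ n - 2 →
      Nonempty (torModule Q M N (i - 1) ≃ₗ[Q] torModule Q M N (i + 1)) := fun i h₁ h₂ => by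
    have := hA (i + 1) (hzero _ (by omega) (by omega)) (hzero _ (by omega) (by omega))
    rwa [show i + 1 - 2 = i - 1 by ring] at this
  obtain ⟨α, β, γ, hαβ, hβγ⟩ := hB m
  have hexact : Function.Exact α (e.symm.toLinearMap ∘ₗ β) ∧
      Function.Exact (e.symm.toLinearMap ∘ₗ β) (γ ∘ₗ e.toLinearMap) := by
    refine ⟨fun x => e.symm.map_eq_zero_iff.trans (hαβ x), fun x => ?_⟩
    refine (hβγ (e x)).trans (exists_congr fun y => ?_)
    exact (LinearEquiv.symm_apply_eq _).symm
  refine ⟨hper, ⟨α, e.symm.toLinearMap ∘ₗ β, γ ∘ₗ e.toLinearMap, hexact⟩, ?_⟩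
  rintro rfl
  let e₀ : TensorProduct Q M N ≃ₗ[Q] torModule Q M N 0 := (torZeroEquiv Q M N).symm
  have : Subsingleton (torModule Q M N (1 - 2)) :=
    subsingleton_torModule_of_neg Q M N (by norm_num)
  have : Subsingleton (torModule Q M N (1 - 3)) :=
    subsingleton_torModule_of_neg Q M N (by norm_num)
  -- For `m = 1` the outer terms have negative index, so the exact sequence collapses to Tor^Q_1 ≅
  -- Tor^R_0.
  have hinj : Function.Injective β := (injective_iff_map_eq_zero _).2 fun x hx => by
    obtain ⟨y, rfl⟩ := (hαβ x).1 hx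
    rw [Subsingleton.elim y 0, map_zero]
  have hsurj : Function.Surjective β := fun x => (hβγ x).1 (Subsingleton.elim _ _)
  -- Since `Q → R` is surjective, the tensor products over `Q` and `R` coincide.
  have : TensorProduct.CompatibleSMul Q (Q ⧸ Ideal.span {f}) M N := by
    refine ⟨fun r x y => ?_⟩
    obtain ⟨q, rfl⟩ := Ideal.Quotient.mk_surjective r
    rw [← Ideal.Quotient.algebraMap_eq, algebraMap_smul, algebraMap_smul,
      TensorProduct.smul_tmul]
  let e₂ : asModuleOver f (torModule (Q ⧸ Ideal.span {f}) M N (1 - 1)) ≃ₗ[Q]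
      M ⊗[Q ⧸ Ideal.span {f}] N := asModuleOverEquiv f (torZeroEquiv _ M N)
  let e₃ : M ⊗[Q ⧸ Ideal.span {f}] N ≃ₗ[Q] M ⊗[Q] N :=
    TensorProduct.equivOfCompatibleSMul Q (Q ⧸ Ideal.span {f}) Q M N
  let e₁ : TensorProduct Q M N ≃ₗ[Q] torModule Q M N 1 :=
    e₃.symm ≪≫ₗ e₂.symm ≪≫ₗ e ≪≫ₗ (LinearEquiv.ofBijective β ⟨hinj, hsurj⟩).symm
  -- Periodicity moves two degrees at a time: odd degrees start from Tor_1, even ones from Tor_0.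
  suffices ∀ (k : ℕ) (i : ℤ), 1 ≤ i → i ≤ n - 1 → i ≤ k →
      Nonempty (TensorProduct Q M N ≃ₗ[Q] torModule Q M N i) from
    fun i h₁ h₂ => this i.toNat i h₁ h₂ (by omega)
  intro k
  induction k with
  | zero => intro i h₁ _ h₃; omega
  | succ k ih =>
    intro i h₁ h₂ h₃
    rcases h₁.eq_or_lt with rfl | h₁
    · exact ⟨e₁⟩
    obtain ⟨e₂⟩ := hper (i - 1) (by omega) (by omega)
    rw [sub_add_cancel] at e₂
    rcases (Int.add_one_le_iff.2 h₁).eq_or_lt with rfl | h₁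
    · exact ⟨e₀ ≪≫ₗ e₂⟩
    · obtain ⟨e₃⟩ := ih (i - 1 - 1) (by omega) (by omega) (by push_cast at h₃; omega)
      exact ⟨e₃ ≪≫ₗ e₂⟩
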